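/- **Setting.** Let $\nu$ be a probability measure on $\mathbb R$ with $\int |y|\,\nu(dy)<\infty$, let $b:\mathbb R\to[0,\infty)$ be Borel and $\nu$-integrable, and write $\mathbb E[b(Y)]=\int b\,d\nu$. Let $\psi:\mathbb R\to[0,\infty)$ be $L$-Lipschitz, $T>0$, $M\in\mathbb N^*$, $\Delta=T/M<T$, and let $h$ be a Borel kernel, integrable on $[0,T]$. Put $(t)_\Delta=\lfloor t/\Delta\rfloor\Delta$, and $$\rho_h=L\,\mathbb E[b(Y)]\int_0^T|h(t)|\,dt,\qquad \rho_{h,\Delta}=L\,\mathbb E[b(Y)]\sum_{k=1}^M|h(k\Delta)|\Delta ,\qquad C_S(h,\Delta)=\frac1{1-\rho_h}+\frac1{1-\rho_{h,\Delta}},$$ $$C_R(h,\Delta)=\int_0^\Delta|h(y)|\,dy+\sup_{\epsilon\in[0,\Delta]}\int_0^{T-\Delta}|h(y+\epsilon)-h(y)|\,dy+\int_0^{T-\Delta}|h(y)-h((y)_\Delta+\Delta)|\,dy .$$ Let $P$ be a Poisson random measure on $\mathbb R_+\times\mathbb R_+\times\mathbb R$ with intensity $dt\,d\theta\,\nu(dy)$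 and $\mathcal F_t=\sigma(P(A): A\subset(0,t]\times\mathbb R_+\times\mathbb R \text{ Borel})$. The continuous-time Hawkes risk $R$ ($\mathcal F$-adapted) and its intensity $\lambda$ ($\mathcal F$-predictable, with a.s. $\int_0^T\lambda_s\,ds<\infty$) solve, a.s. for all $t\in[0,T]$, $$R_t=\int_{(0,t]\times\mathbb R_+\times\mathbb R} y\,\mathbf 1_{\theta\le\lambda_s}\,P(ds,d\theta,dy),\qquad \lambda_t=\psi\Big(\int_{[0,t)\times\mathbb R_+\times\mathbb R}h(t-s)\,b(y)\,\mathbf 1_{\theta\le\lambda_s}\,P(ds,d\theta,dy)\Big).$$ The discrete-time Hawkes risk $R^\Delta$ is built from the same $P$ by $$l_n=\psi\Big(\sum_{k=1}^{n-1}h((n-k)\Delta)X_k\Big),\qquad X_n=\int_{((n-1)\Delta,n\Delta]\times\mathbb R_+\times\mathbb R}b(y)\,\mathbf 1_{\theta\le l_n}\,P(ds,d\theta,dy)\quad(n\ge1),$$ $$R^\Delta_t=\sum_{k=1}^{\lfloor t/\Delta\rfloor}\int_{((k-1)\Delta,k\Delta]\times\mathbb R_+\times\mathbb R}y\,\mathbf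 1_{\theta\le l_k}\,P(ds,d\theta,dy).$$ **Proposition.** Let $L\ge 0$, $\nu$, $b$ be as above, let $p\in\mathbb R$ and $r<1$. There is a constant $K>0$, depending only on $L,\nu,b,p,r$, such that the following holds for all $T$, $\Delta=T/M<T$, $h$, $\psi$, $P$ as above for which $\psi(0)\le p$, $\rho_h\le r$ (so $\rho_h<1$) and $\rho_{h,\Delta}<1$: for all $0\le s\le t\le T$, the random variable $(R_t-R_s)-(R^\Delta_t-R^\Delta_s)$ is integrable and $$\mathbb E\big|(R_t-R_s)-(R^\Delta_t-R^\Delta_s)\big|\le K\Big(C_S(h,\Delta)\,C_R(h,\Delta)\,\big[(t)_\Delta-(s)_\Delta\big]+\Delta\Big).$$ In particular $K$ does not depend on $T$ and $\Delta$, and it depends on $h$ only through an upper bound of $\rho_h$ and on $\psi$ only through $L$ and an upper bound of $\psi(0)$. -/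

import Mathlib

open MeasureTheory ProbabilityTheory Set
open scoped NNReal ENNReal

namespace HawkesRisk

/-- The space `ℝ₊ × ℝ₊ × ℝ` of points `(s, θ, y)`: time, height, mark. -/
abbrev Pt : Type := ℝ≥0 × ℝ≥0 × ℝ

/-- Lebesgue measure on `ℝ₊`. -/
noncomputable def lebesgueNN : Measure ℝ≥0 := Measure.comap ((↑) : ℝ≥0 → ℝ) volume

/-- The intensity measure `ds ⊗ dθ ⊗ ν(dy)`. -/
noncomputable def intensityMeasure (ν : Measure ℝ) : Measure Pt :=
  lebesgueNN.prod (lebesgueNN.prod ν)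

/-- `P` is, under the measure `Q`, a Poisson random measure on `E` with intensity `μ`. -/
structure IsPoissonMeasure {Ω E : Type*} [MeasurableSpace Ω] [MeasurableSpace E]
    (P : Ω → Measure E) (μ : Measure E) (Q : Measure Ω) : Prop where
  measurable : Measurable P
  law : ∀ A : Set E, MeasurableSet A → μ A ≠ ∞ →
    HasLaw (fun ω => P ω A)
      ((poissonMeasure (μ A).toNNReal).map (fun n : ℕ => (n : ℝ≥0∞))) Q
  indep : ∀ (n : ℕ) (A : Fin n → Set E), (∀ i, MeasurableSet (A i)) →
    Pairwise (fun i j => Disjoint (A i) (A j)) →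
    iIndepFun (fun i ω => P ω (A i)) Q

/-- The filtration of a random measure on `ℝ₊ × ℝ₊ × ℝ`: `ℱ t` is generated by the variables
`P(A)`, where `A` runs through the Borel subsets of `(0, t] × ℝ₊ × ℝ`. -/
def poissonFiltration {Ω : Type*} [mΩ : MeasurableSpace Ω] (P : Ω → Measure Pt)
    (hP : Measurable P) : Filtration ℝ≥0 mΩ where
  seq t := ⨆ A ∈ {A : Set Pt | MeasurableSet A ∧ A ⊆ Ioc 0 t ×ˢ univ},
    MeasurableSpace.comap (fun ω => P ω A) inferInstance
  mono' s t hst := by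
    refine iSup₂_le fun A hA => ?_
    refine le_iSup₂_of_le (f := fun (A : Set Pt)
      (_ : A ∈ {A : Set Pt | MeasurableSet A ∧ A ⊆ Ioc 0 t ×ˢ univ}) =>
        MeasurableSpace.comap (fun ω => P ω A) inferInstance) A ⟨hA.1, hA.2.trans ?_⟩ le_rfl
    exact prod_mono (Ioc_subset_Ioc_right hst) subset_rfl
  le' t := iSup₂_le fun A hA => ((Measure.measurable_coe hA.1).comp hP).comap_le

/-- The points `(s, θ, y)` lying under the curve `ℓ`, that is `θ ≤ ℓ s`. -/
def under (ℓ : ℝ≥0 → ℝ) : Set Pt := {z | (z.2.1 : ℝ) ≤ ℓ z.1}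

/-- `(R, lam)` is a solution on `[0, T]` of the equation of the marked Hawkes risk process with
kernel `h`, jump rate `ψ` and marks modulation function `b`, thinned from `P`. The path of `lam` is
integrable on `[0, T]`, so that only finitely many points are accepted there. -/
structure IsHawkes {Ω : Type*} [MeasurableSpace Ω] (Q : Measure Ω) (P : Ω → Measure Pt)
    (hP : Measurable P) (T : ℝ≥0) (h ψ b : ℝ → ℝ) (R lam : ℝ≥0 → Ω → ℝ) : Prop where
  adapted : StronglyAdapted (poissonFiltration P hP) R
  predictable : IsStronglyPredictable (poissonFiltration P hP) lam
  integrable_path : ∀ᵐ ω ∂Q, IntegrableOn (fun s => lam s ω) (Icc 0 T) lebesgueNN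
  risk_eq : ∀ᵐ ω ∂Q, ∀ t ∈ Icc 0 T,
    R t ω = ∫ z in Ioc 0 t ×ˢ univ,
      (under fun s => lam s ω).indicator (fun z : Pt => z.2.2) z ∂(P ω)
  intensity_eq : ∀ᵐ ω ∂Q, ∀ t ∈ Icc 0 T,
    lam t ω = ψ (∫ z in Ico 0 t ×ˢ univ,
      (under fun s => lam s ω).indicator
        (fun z : Pt => h ((t : ℝ) - (z.1 : ℝ)) * b z.2.2) z ∂(P ω))

/-- `∫_{((k-1)Δ, kΔ] × ℝ₊ × ℝ} f(y) 1_{θ ≤ ℓ} m(ds, dθ, dy)`, for `k ≥ 1`. -/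
noncomputable def binIntegral (m : Measure Pt) (Δ : ℝ≥0) (f : ℝ → ℝ) (k : ℕ) (ℓ : ℝ) : ℝ :=
  ∫ z in Ioc (((k - 1 : ℕ) : ℝ≥0) * Δ) ((k : ℝ≥0) * Δ) ×ˢ univ,
    (under fun _ => ℓ).indicator (fun z : Pt => f z.2.2) z ∂m

/-- The discrete intensity sequence `l_n`, for a realisation `m` of the Poisson measure. -/
noncomputable def discreteIntensity (m : Measure Pt) (Δ : ℝ≥0) (h ψ b : ℝ → ℝ) (n : ℕ) : ℝ :=
  ψ (∑ k ∈ (Finset.Ico 1 n).attach,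
    h (((n : ℝ) - (k.1 : ℝ)) * (Δ : ℝ)) *
      binIntegral m Δ b k.1 (discreteIntensity m Δ h ψ b k.1))
termination_by n
decreasing_by exact (Finset.mem_Ico.mp k.2).2

/-- The variables `X_n`. -/
noncomputable def discreteMark (m : Measure Pt) (Δ : ℝ≥0) (h ψ b : ℝ → ℝ) (n : ℕ) : ℝ :=
  if n = 0 then 0 else binIntegral m Δ b n (discreteIntensity m Δ h ψ b n)

/-- The recursion `l_n = ψ (∑_{k=1}^{n-1} h((n-k)Δ) X_k)`. -/
theorem discreteIntensity_eq (m : Measure Pt) (Δ : ℝ≥0) (h ψ b : ℝ → ℝ) (n : ℕ) :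
    discreteIntensity m Δ h ψ b n =
      ψ (∑ k ∈ Finset.Ico 1 n,
        h (((n : ℝ) - (k : ℝ)) * (Δ : ℝ)) * discreteMark m Δ h ψ b k) := by
  rw [discreteIntensity, ← Finset.sum_attach (Finset.Ico 1 n)]
  congr 1
  refine Finset.sum_congr rfl fun k _ => ?_
  have hk : k.1 ≠ 0 := by have := (Finset.mem_Ico.mp k.2).1; omega
  rw [discreteMark, if_neg hk]

/-- The discrete-time Hawkes risk
`R^Δ_t = ∑_{k=1}^{⌊t/Δ⌋} ∫_{((k-1)Δ, kΔ] × ℝ₊ × ℝ} y 1_{θ ≤ l_k} m(ds, dθ, dy)`. -/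
noncomputable def discreteRisk (m : Measure Pt) (Δ : ℝ≥0) (h ψ b : ℝ → ℝ) (t : ℝ≥0) : ℝ :=
  ∑ k ∈ Finset.Icc 1 ⌊t / Δ⌋₊, binIntegral m Δ (fun y => y) k (discreteIntensity m Δ h ψ b k)

/-- The projection `(t)_Δ = ⌊t/Δ⌋ Δ` on the time grid. -/
noncomputable def gridProj (Δ t : ℝ) : ℝ := (⌊t / Δ⌋ : ℝ) * Δ

/-- `ρ_h = L ‖h‖₁ 𝔼[b(Y)]`, the norm being that of `L¹([0, T])`. -/
noncomputable def rho (L : ℝ) (ν : Measure ℝ) (b h : ℝ → ℝ) (T : ℝ) : ℝ :=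
  L * (∫ t in (0 : ℝ)..T, |h t|) * ∫ y, b y ∂ν

/-- `ρ_{h,Δ} = L ∑_{k=1}^M |h(kΔ)| Δ 𝔼[b(Y)]`. -/
noncomputable def rhoDiscrete (L : ℝ) (ν : Measure ℝ) (b h : ℝ → ℝ) (M : ℕ) (Δ : ℝ) : ℝ :=
  L * (∑ k ∈ Finset.Icc 1 M, |h ((k : ℝ) * Δ)| * Δ) * ∫ y, b y ∂ν

/-- `C_S(h,Δ) = 1/(1-ρ_h) + 1/(1-ρ_{h,Δ})`. -/
noncomputable def constS (L : ℝ) (ν : Measure ℝ) (b h : ℝ → ℝ) (T : ℝ) (M : ℕ) (Δ : ℝ) : ℝ :=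
  1 / (1 - rho L ν b h T) + 1 / (1 - rhoDiscrete L ν b h M Δ)

/-- The constant `C_R(h,Δ)`, which measures the regularity of the kernel on `[0, T]`. -/
noncomputable def constR (h : ℝ → ℝ) (T Δ : ℝ) : ℝ :=
  (∫ y in (0 : ℝ)..Δ, |h y|)
    + sSup ((fun ε => ∫ y in (0 : ℝ)..(T - Δ), |h (y + ε) - h y|) '' Icc 0 Δ)
    + ∫ y in (0 : ℝ)..(T - Δ), |h y - h (gridProj Δ y + Δ)|

end HawkesRisk

namespace HawkesRisk

/-! ### Poisson random measures: means, and independence of past and future. -/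

section Poisson

/-! Both risks are integrals of predictable indicators against the same `P`. Extend the discrete
intensity to the step process s ↦ l_{⌈s/Δ⌉}; it is predictable, up to a null set, because l_n only
uses `P` on (0, (n-1)Δ]. The compensation formula `IsPoissonMeasure.lintegral_predictable` then
applies to both: the expected integral of a nonnegative predictable integrand against `P` equals the
one against ds dθ ν(dy). Since the height sets {θ ≤ a} and {θ ≤ a'} differ by a set of length at
most |a - a'|, expected distances between thinned integrals are controlled by L¹ distances between
intensities (`IsPoissonMeasure.lintegral_accepted_sub_le`).

Three estimates follow. (1) Means. Lipschitz continuity of ψ and compensation give E λ_t ≤ p + L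
E[b(Y)] ∫_0^t |h(t-s)| E λ_s ds. This is a Volterra inequality whose kernel has mass at most r < 1,
so `le_of_le_add_convolution` yields E λ_t ≤ p/(1-r). Induction on n gives E l_n ≤ p/(1-ρ_{h,Δ}).
(2) Distance of intensities. The function δ(t) = E|λ_t - l_{⌈t/Δ⌉}| satisfies the same kind of
inequality, with source term L E[b(Y)] C_R p/(1-ρ_{h,Δ}): the constant C_R bounds the L¹ error made
when h(t-s) is replaced by its value at a grid lag (`lintegral_sub_discretised_kernel_le`). Hence δ
≤ L E[b(Y)] C_R p/((1-r)(1-ρ_{h,Δ})). (3) Risks. The increment of R lives on (s,t], that of R^Δ on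
((s)_Δ,(t)_Δ]. The grid window contributes E|Y| ((t)_Δ-(s)_Δ) sup δ. The two windows differ by at
most two intervals of length Δ, charged with E λ only; they cost 2Δ E|Y| p/(1-r), in which ρ_{h,Δ}
does not appear.

The Volterra argument needs an integrable function, whereas λ is only known to have almost surely
integrable paths. In (1) λ is therefore localised by the predictable indicator of {∫_0^t λ ≤ n}; in
(2) integrability comes from (1). -/

theorem lintegral_cast_poissonMeasure (r : ℝ≥0) :
    ∫⁻ n : ℕ, (n : ℝ≥0∞) ∂poissonMeasure r = r := by
  have h : HasSum (fun n : ℕ => Real.exp (-r) * (r : ℝ) ^ n / n.factorial * n) (r : ℝ) := by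
    rw [← hasSum_nat_add_iff' 1]
    simp only [Finset.range_one, Finset.sum_singleton, Nat.cast_zero, mul_zero, sub_zero]
    have := (hasSum_one_poissonMeasure r).mul_left (r : ℝ)
    rw [mul_one] at this
    have he : (fun n : ℕ => Real.exp (-r) * (r : ℝ) ^ (n + 1) / (n + 1).factorial *
        ((n + 1 : ℕ) : ℝ)) = fun n => r * (Real.exp (-r) * r ^ n / n.factorial) := by
      funext n
      rw [Nat.factorial_succ]
      push_cast
      field_simp
      ring
    rwa [he]
  rw [poissonMeasure, lintegral_sum_measure]
  simp only [lintegral_smul_measure, lintegral_dirac, smul_eq_mul]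
  have h0 : ∀ n : ℕ, 0 ≤ Real.exp (-r) * (r : ℝ) ^ n / n.factorial * n := fun n => by positivity
  calc _ = ∑' n : ℕ, ENNReal.ofReal (Real.exp (-r) * (r : ℝ) ^ n / n.factorial * n) := by
        refine tsum_congr fun n => ?_
        rw [ENNReal.ofReal_mul (by positivity), ENNReal.ofReal_natCast]
    _ = _ := by rw [← ENNReal.ofReal_tsum_of_nonneg h0 h.summable, h.tsum_eq,
                  ENNReal.ofReal_coe_nnreal]

variable {Ω E : Type*} [MeasurableSpace Ω] [MeasurableSpace E] {P : Ω → Measure E}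
  {μ : Measure E} {Q : Measure Ω}

theorem IsPoissonMeasure.lintegral_apply (hP : IsPoissonMeasure P μ Q) {A : Set E}
    (hA : MeasurableSet A) (hμA : μ A ≠ ∞) : ∫⁻ ω, P ω A ∂Q = μ A := by
  have h := (hP.law A hA hμA).lintegral_comp (f := fun x => x) aemeasurable_id'
  rw [h, lintegral_map measurable_id' (by fun_prop), lintegral_cast_poissonMeasure,
    ENNReal.coe_toNNReal hμA]

theorem IsPoissonMeasure.ae_apply_lt_top (hP : IsPoissonMeasure P μ Q) {A : Set E}
    (hA : MeasurableSet A) (hμA : μ A ≠ ∞) : ∀ᵐ ω ∂Q, P ω A < ∞ :=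
  ae_lt_top ((Measure.measurable_coe hA).comp hP.measurable) (by rwa [hP.lintegral_apply hA hμA])

open Classical in
/-- The variables `P(A)`, for `A` inside `D`, are independent of `P(C)` for `C` disjoint
from `D`. -/
theorem IsPoissonMeasure.indep_iSup_comap [IsProbabilityMeasure Q] (hP : IsPoissonMeasure P μ Q)
    {C D : Set E} (hC : MeasurableSet C) (hCD : Disjoint C D) :
    Indep (⨆ A ∈ {A : Set E | MeasurableSet A ∧ A ⊆ D},
        MeasurableSpace.comap (fun ω => P ω A) inferInstance)
      (MeasurableSpace.comap (fun ω => P ω C) inferInstance) Q := by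
  have hmeas : ∀ A : Set E, MeasurableSet A → Measurable fun ω => P ω A := fun A hA =>
    (Measure.measurable_coe hA).comp hP.measurable
  -- The hypothesis only concerns disjoint sets, so the σ-algebra is exhausted by those of finite
  -- families, which split into disjoint atoms. The outer atom (the all-false index) is the only one
  -- that need not lie in `D`; its slot is given to `C`.
  rw [iSup_subtype', iSup_eq_iSup_finset]
  refine indep_iSup_of_directed_le (fun S => ?_) (fun S => ?_) ?_ ?_
  · -- the atoms of the finite family `S`, and `C` in place of the outer atom
    let α : (S → Bool) → Set E := fun J =>
      if J = fun _ => false then C else ⋂ A : S, if J A then A.1.1 else (A.1.1)ᶜ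
    have hα : ∀ J, MeasurableSet (α J) := fun J => by
      simp only [α]
      split_ifs
      · exact hC
      · refine MeasurableSet.iInter fun A => ?_
        split_ifs
        · exact A.1.2.1
        · exact A.1.2.1.compl
    have hsub : ∀ J, J ≠ (fun _ => false) → α J ⊆ D := fun J hJ => by
      simp only [α, if_neg hJ]
      obtain ⟨A, hA⟩ : ∃ A, J A = true := by
        by_contra! h
        exact hJ (funext fun A => by simpa using h A)
      refine (iInter_subset _ A).trans ?_
      rw [if_pos hA]
      exact A.1.2.2
    have hdisj : Pairwise fun i j => Disjoint (α i) (α j) := by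
      intro I J hIJ
      by_cases hI : I = fun _ => false
      · have hJ : J ≠ fun _ => false := fun h => hIJ (hI.trans h.symm)
        have : α I = C := by simp [α, hI]
        rw [this]
        exact hCD.mono_right (hsub J hJ)
      by_cases hJ : J = fun _ => false
      · have : α J = C := by simp [α, hJ]
        rw [this]
        exact (hCD.mono_right (hsub I hI)).symm
      obtain ⟨A, hA⟩ := Function.ne_iff.mp hIJ
      simp only [α, if_neg hI, if_neg hJ]
      refine Disjoint.mono (iInter_subset _ A) (iInter_subset _ A) ?_
      cases h1 : I A <;> cases h2 : J A <;>
        simp_all [disjoint_compl_right, disjoint_compl_left]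
    have hind : iIndepFun (fun J ω => P ω (α J)) Q := by
      let e := Fintype.equivFin (S → Bool)
      have h1 := hP.indep _ (fun i => α (e.symm i)) (fun i => hα _)
        (fun i j hij => hdisj (e.symm.injective.ne hij))
      simpa using h1.precomp e.injective
    have key := indep_iSup_of_disjoint (fun J => (hmeas _ (hα J)).comap_le) hind
      (S := {J | J ≠ fun _ => false}) (T := {fun _ => false})
      (by rw [Set.disjoint_singleton_right]; simp)
    refine indep_of_indep_of_le_left (indep_of_indep_of_le_right key ?_) ?_
    · have : α (fun _ => false) = C := by simp [α]
      refine le_iSup₂_of_le (f := fun J (_ : J ∈ ({fun _ => false} : Set (S → Bool))) =>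
        MeasurableSpace.comap (fun ω => P ω (α J)) inferInstance) _ rfl ?_
      rw [this]
    · refine iSup₂_le fun A hA => ?_
      -- Each set of the family is the disjoint union of the atoms it contains, so its measure is a
      -- finite sum of independent variables not involving `C`.
      have hsum : (fun ω => P ω A.1) = fun ω =>
          ∑ J ∈ Finset.univ.filter (fun J : S → Bool => J ⟨A, hA⟩ = true), P ω (α J) := by
        funext ω
        rw [← measure_biUnion_finset (fun I _ J _ hIJ => hdisj hIJ) (fun J _ => hα J)]
        congr 1
        ext x
        simp only [Finset.mem_filter, Finset.mem_univ, true_and, mem_iUnion, exists_prop]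
        constructor
        · intro hx
          refine ⟨fun B => decide (x ∈ B.1.1), by simpa using hx, ?_⟩
          have hne : (fun B : S => decide (x ∈ B.1.1)) ≠ fun _ => false := fun h => by
            have := congrFun h ⟨A, hA⟩
            simp [hx] at this
          simp only [α, if_neg hne, mem_iInter]
          intro B
          by_cases hB : x ∈ B.1.1 <;> simp [hB]
        · rintro ⟨J, hJ, hx⟩
          have hne : J ≠ fun _ => false := fun h => by simp [h] at hJ
          simp only [α, if_neg hne, mem_iInter] at hx
          simpa [hJ] using hx ⟨A, hA⟩
      rw [hsum, ← measurable_iff_comap_le]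
      refine Finset.measurable_sum _ fun J hJ => ?_
      have hne : J ≠ fun _ => false := fun h => by simp [h] at hJ
      refine Measurable.mono (comap_measurable _) ?_ le_rfl
      exact le_iSup₂_of_le (f := fun J (_ : J ∈ {J : S → Bool | J ≠ fun _ => false}) =>
        MeasurableSpace.comap (fun ω => P ω (α J)) inferInstance) J hne le_rfl
  · exact iSup₂_le fun A _ => (hmeas _ A.2.1).comap_le
  · exact (hmeas _ hC).comap_le
  · refine Monotone.directed_le fun S S' h => ?_
    exact biSup_mono fun A hA => h hA

end Poisson

/-! ### Random measures as s-finite kernels, and uniqueness of measures on products. -/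

section Kernel

variable {α β : Type*} [MeasurableSpace α] [MeasurableSpace β]

/-- Finite total masses need not be uniformly bounded; slicing the parameter space by the integer
part of the mass gives countably many finite kernels. -/
theorem isSFiniteKernel_of_univ_lt_top (κ : Kernel α β) (h : ∀ a, κ a univ < ∞) :
    IsSFiniteKernel κ := by
  classical
  have hm : Measurable fun a => κ a univ := κ.measurable_coe MeasurableSet.univ
  let s : ℕ → Set α := fun j => {a | (j : ℝ≥0∞) ≤ κ a univ ∧ κ a univ < (j : ℝ≥0∞) + 1}
  have hs : ∀ j, MeasurableSet (s j) := fun j =>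
    (measurableSet_le measurable_const hm).inter (measurableSet_lt hm measurable_const)
  have hfin : ∀ j, IsFiniteKernel (Kernel.piecewise (hs j) κ 0) := fun j => by
    refine ⟨⟨(j : ℝ≥0∞) + 1, by finiteness, fun a => ?_⟩⟩
    rw [Kernel.piecewise_apply]
    split_ifs with ha
    · exact ha.2.le
    · simp
  have hsum : κ = Kernel.sum fun j => Kernel.piecewise (hs j) κ 0 := by
    ext a B hB
    rw [Kernel.sum_apply' _ _ hB, tsum_eq_single ⌊(κ a univ).toReal⌋₊]
    · rw [Kernel.piecewise_apply, if_pos]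
      have h0 : κ a univ = ENNReal.ofReal (κ a univ).toReal :=
        (ENNReal.ofReal_toReal (h a).ne).symm
      constructor
      · rw [h0, ← ENNReal.ofReal_natCast, ENNReal.toReal_ofReal ENNReal.toReal_nonneg]
        exact ENNReal.ofReal_le_ofReal (Nat.floor_le ENNReal.toReal_nonneg)
      · rw [h0, ← ENNReal.ofReal_natCast, ENNReal.toReal_ofReal ENNReal.toReal_nonneg,
          ← ENNReal.ofReal_one, ← ENNReal.ofReal_add (by positivity) zero_le_one]
        exact (ENNReal.ofReal_lt_ofReal_iff (by positivity)).2 (Nat.lt_floor_add_one _)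
    · intro j hj
      rw [Kernel.piecewise_apply, if_neg]
      · simp
      · rintro ⟨h1, h2⟩
        refine hj ((Nat.floor_eq_iff ENNReal.toReal_nonneg).2 ⟨?_, ?_⟩).symm
        · simpa using ENNReal.toReal_mono (h a).ne h1
        · have := (ENNReal.toReal_lt_toReal (h a).ne (by finiteness)).2 h2
          rwa [ENNReal.toReal_add (by simp) (by simp), ENNReal.toReal_natCast,
            ENNReal.toReal_one] at this
  rw [hsum]
  infer_instance

/-- Disjointing the exhaustion reduces to kernels with finite total mass. A Poisson measure has
infinite mass, but finite mass on windows. -/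
theorem isSFiniteKernel_of_iUnion (κ : Kernel α β) {D : ℕ → Set β}
    (hD : ∀ n, MeasurableSet (D n)) (hU : ⋃ n, D n = univ) (h : ∀ a n, κ a (D n) < ∞) :
    IsSFiniteKernel κ := by
  have hd := fun n => MeasurableSet.disjointed hD n
  have hsum : κ = Kernel.sum fun n => κ.restrict (hd n) := by
    ext a B hB
    rw [Kernel.sum_apply' _ _ hB]
    simp only [Kernel.restrict_apply' _ _ _ hB]
    rw [← measure_iUnion _ fun n => hB.inter (hd n), ← inter_iUnion, iUnion_disjointed, hU,
      inter_univ]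
    exact fun i j hij => ((disjoint_disjointed D hij).mono inter_subset_right inter_subset_right)
  rw [hsum]
  have hfin : ∀ n, IsSFiniteKernel (κ.restrict (hd n)) := fun n =>
    isSFiniteKernel_of_univ_lt_top _ fun a => by
      rw [Kernel.restrict_apply' _ _ _ MeasurableSet.univ, univ_inter]
      exact (measure_mono (disjointed_subset D n)).trans_lt (h a n)
  infer_instance

open Classical in
/-- A random measure that is locally finite on `W`, made into an s-finite kernel. -/
theorem exists_kernel_eq_restrict {P : α → Measure β} {W : Set β} (hW : MeasurableSet W)
    {D : ℕ → Set β} (hD : ∀ n, MeasurableSet (D n)) (hU : ⋃ n, D n = univ)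
    (hP : ∀ A, MeasurableSet A → A ⊆ W → Measurable fun a => P a A) :
    ∃ κ : Kernel α β, IsSFiniteKernel κ ∧
      ∀ a, (∀ n, P a (W ∩ D n) < ∞) → κ a = (P a).restrict W := by
  -- Where local finiteness fails the measure is replaced by 0. Only sets inside `W` are involved,
  -- so the result stays measurable for the σ-algebra of the past when `W` is the past.
  let G : Set α := ⋂ n, {a | P a (W ∩ D n) < ∞}
  have hG : MeasurableSet G := MeasurableSet.iInter fun n =>
    measurableSet_lt (hP _ (hW.inter (hD n)) inter_subset_left) measurable_const
  have hr : Measurable fun a => (P a).restrict W := by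
    refine Measure.measurable_of_measurable_coe _ fun A hA => ?_
    simp only [Measure.restrict_apply hA]
    exact hP _ (hA.inter hW) inter_subset_right
  let κ : Kernel α β := ⟨fun a => if a ∈ G then (P a).restrict W else 0,
    Measurable.ite hG hr measurable_const⟩
  have hκ : ∀ a, κ a = if a ∈ G then (P a).restrict W else 0 := fun a => rfl
  refine ⟨κ, isSFiniteKernel_of_iUnion κ hD hU fun a n => ?_, fun a ha => ?_⟩
  · rw [hκ]
    split_ifs with ha
    · rw [Measure.restrict_apply (hD n), inter_comm]
      exact mem_iInter.1 ha n
    · simp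
  · rw [hκ, if_pos (mem_iInter.2 ha)]

/-- A π-λ argument on rectangles. The σ-algebra of the first factor is arbitrary, so that it can be
the predictable one. -/
theorem ext_of_generateFrom_prod {C : Set (Set α)} (hC : ‹MeasurableSpace α› =
    MeasurableSpace.generateFrom C) (hpi : IsPiSystem C) (hspan : IsCountablySpanning C)
    {m₁ m₂ : Measure (α × β)} [IsFiniteMeasure m₁]
    (h : ∀ s ∈ C, ∀ B, MeasurableSet B → m₁ (s ×ˢ B) = m₂ (s ×ˢ B))
    (hu : m₁ univ = m₂ univ) : m₁ = m₂ := by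
  refine ext_of_generate_finite (image2 (· ×ˢ ·) C {B | MeasurableSet B}) ?_
    (hpi.prod MeasurableSpace.isPiSystem_measurableSet) ?_ hu
  · have e := generateFrom_prod_eq hspan (isCountablySpanning_measurableSet (α := β))
    rw [← hC, MeasurableSpace.generateFrom_measurableSet] at e
    exact e
  · rintro _ ⟨s, hs, B, hB, rfl⟩
    exact h s hs B hB

end Kernel

/-! ### Lebesgue measure on the half-line. -/

section Lebesgue

theorem measurableEmbedding_coe_nnreal : MeasurableEmbedding ((↑) : ℝ≥0 → ℝ) :=
  MeasurableEmbedding.subtype_coe measurableSet_Ici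

theorem map_coe_lebesgueNN : lebesgueNN.map ((↑) : ℝ≥0 → ℝ) = volume.restrict (Ici 0) := by
  rw [lebesgueNN, measurableEmbedding_coe_nnreal.map_comap, NNReal.range_coe]

theorem setLIntegral_lebesgueNN {A : Set ℝ} (hA : MeasurableSet A) (hA0 : A ⊆ Ici 0)
    (f : ℝ → ℝ≥0∞) :
    ∫⁻ s : ℝ≥0 in (↑) ⁻¹' A, f s ∂lebesgueNN = ∫⁻ x in A, f x := by
  rw [← measurableEmbedding_coe_nnreal.lintegral_map,
    ← measurableEmbedding_coe_nnreal.restrict_map, map_coe_lebesgueNN,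
    Measure.restrict_restrict hA, inter_eq_left.2 hA0]

theorem lebesgueNN_preimage {A : Set ℝ} (hA : MeasurableSet A) (hA0 : A ⊆ Ici 0) :
    lebesgueNN ((↑) ⁻¹' A) = volume A := by
  have := setLIntegral_lebesgueNN hA hA0 fun _ => 1
  simpa using this

theorem lebesgueNN_Ioc (a b : ℝ≥0) : lebesgueNN (Ioc a b) = ENNReal.ofReal (b - a) := by
  have : Ioc a b = (↑) ⁻¹' Ioc (a : ℝ) b := by ext; simp
  have h0 : Ioc (a : ℝ) b ⊆ Ici 0 := fun x hx => a.2.trans hx.1.le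
  rw [this, lebesgueNN_preimage measurableSet_Ioc h0, Real.volume_Ioc]

theorem lebesgueNN_Iic (a : ℝ≥0) : lebesgueNN (Iic a) = a := by
  have : Iic a = (↑) ⁻¹' Icc (0 : ℝ) a := by ext; simp
  rw [this, lebesgueNN_preimage measurableSet_Icc Icc_subset_Ici_self]
  simp

theorem lebesgueNN_singleton (a : ℝ≥0) : lebesgueNN {a} = 0 := by
  have : ({a} : Set ℝ≥0) = (↑) ⁻¹' {(a : ℝ)} := by ext; simp
  rw [this, lebesgueNN_preimage (measurableSet_singleton _) (by simp)]
  simp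

instance : NullSingletonClass lebesgueNN := ⟨lebesgueNN_singleton⟩

instance : SigmaFinite lebesgueNN :=
  ⟨⟨⟨fun n => Iic (n : ℝ≥0), fun _ => trivial, fun n => by simp [lebesgueNN_Iic],
    by
      ext x
      simpa using exists_nat_ge x⟩⟩⟩

instance (ν : Measure ℝ) [SFinite ν] : SFinite (intensityMeasure ν) := by
  unfold intensityMeasure; infer_instance

end Lebesgue

/-! ### Generators of the predictable σ-algebra. -/

section Predictable

variable {Ω : Type*} [mΩ : MeasurableSpace Ω] (ℱ : Filtration ℝ≥0 mΩ)

/-- The generating sets `{0} × A`, `A ∈ ℱ 0`, and `(a, ∞) × A`, `A ∈ ℱ a`, of the predictable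
σ-algebra. -/
def predictableRect : Set (Set (ℝ≥0 × Ω)) :=
  {s | ∃ A, MeasurableSet[ℱ ⊥] A ∧ s = {⊥} ×ˢ A} ∪
    {s | ∃ i A, MeasurableSet[ℱ i] A ∧ s = Ioi i ×ˢ A}

theorem isPiSystem_predictableRect : IsPiSystem (predictableRect ℱ) := by
  rintro s (⟨A, hA, rfl⟩ | ⟨i, A, hA, rfl⟩) t (⟨B, hB, rfl⟩ | ⟨j, B, hB, rfl⟩) hne
  · exact Or.inl ⟨A ∩ B, hA.inter hB, by rw [prod_inter_prod, inter_self]⟩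
  · obtain ⟨⟨x, ω⟩, ⟨h1, -⟩, h2, -⟩ := hne
    simp only [mem_singleton_iff] at h1
    simp [h1] at h2
  · obtain ⟨⟨x, ω⟩, ⟨h2, -⟩, h1, -⟩ := hne
    simp only [mem_singleton_iff] at h1
    simp [h1] at h2
  · refine Or.inr ⟨i ⊔ j, A ∩ B, ?_, by rw [prod_inter_prod, Ioi_inter_Ioi]⟩
    exact (ℱ.mono le_sup_left _ hA).inter (ℱ.mono le_sup_right _ hB)

theorem isCountablySpanning_predictableRect : IsCountablySpanning (predictableRect ℱ) := by
  refine ⟨fun n => if n = 0 then {⊥} ×ˢ univ else Ioi ⊥ ×ˢ univ, fun n => ?_, ?_⟩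
  · dsimp only
    split_ifs
    · exact Or.inl ⟨univ, MeasurableSet.univ, rfl⟩
    · exact Or.inr ⟨⊥, univ, MeasurableSet.univ, rfl⟩
  · refine eq_univ_of_forall fun ⟨x, ω⟩ => mem_iUnion.2 ?_
    by_cases hx : x = ⊥
    · exact ⟨0, by simp [hx]⟩
    · exact ⟨1, by simpa using pos_iff_ne_zero.2 hx⟩

theorem predictable_le : ℱ.predictable ≤ (inferInstance : MeasurableSpace (ℝ≥0 × Ω)) :=
  measurableSpace_le_predictable_of_measurableSet
    (fun _ hA => (measurableSet_singleton _).prod (ℱ.le _ _ hA))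
    (fun _ _ hA => measurableSet_Ioi.prod (ℱ.le _ _ hA))

/-- Regroups `(ω, (s, θ, y))` as `((s, ω), (θ, y))`. -/
def regroup (p : Ω × Pt) : (ℝ≥0 × Ω) × (ℝ≥0 × ℝ) := ((p.2.1, p.1), p.2.2)

theorem measurable_regroup : @Measurable _ _ _
    (@Prod.instMeasurableSpace _ _ ℱ.predictable inferInstance) (regroup (Ω := Ω)) := by
  have h : Measurable (regroup (Ω := Ω)) := by unfold regroup; fun_prop
  exact h.mono le_rfl (sup_le_sup (MeasurableSpace.comap_mono (predictable_le ℱ)) le_rfl)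

end Predictable

/-! ### The compensation formula. -/

section Compensation

/-- The points with time and height at most `N`. -/
def window (N : ℕ) : Set Pt := Iic (N : ℝ≥0) ×ˢ (Iic (N : ℝ≥0) ×ˢ univ)

theorem measurableSet_window (N : ℕ) : MeasurableSet (window N) :=
  measurableSet_Iic.prod (measurableSet_Iic.prod MeasurableSet.univ)

theorem window_mono : Monotone window := fun m n h => by
  have : (m : ℝ≥0) ≤ n := Nat.cast_le.2 h
  exact prod_mono (Iic_subset_Iic.2 this) (prod_mono (Iic_subset_Iic.2 this) subset_rfl)

theorem iUnion_window : ⋃ N, window N = univ := by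
  refine eq_univ_of_forall fun z => mem_iUnion.2 ?_
  obtain ⟨n, hn⟩ := exists_nat_ge (max z.1 z.2.1)
  exact ⟨n, (le_max_left _ _).trans hn, (le_max_right _ _).trans hn, trivial⟩

variable {ν : Measure ℝ} [IsProbabilityMeasure ν]

theorem intensityMeasure_window_lt_top (N : ℕ) : intensityMeasure ν (window N) < ∞ := by
  rw [window, intensityMeasure, Measure.prod_prod, Measure.prod_prod, lebesgueNN_Iic]
  simp only [measure_univ]
  finiteness

theorem intensityMeasure_singleton_prod (a : ℝ≥0) (B : Set (ℝ≥0 × ℝ)) :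
    intensityMeasure ν ({a} ×ˢ B) = 0 := by
  rw [intensityMeasure, Measure.prod_prod, lebesgueNN_singleton, zero_mul]

variable {Ω : Type*} [MeasurableSpace Ω] {Q : Measure Ω}
  {P : Ω → Measure Pt}

theorem IsPoissonMeasure.ae_window_lt_top (hP : IsPoissonMeasure P (intensityMeasure ν) Q) :
    ∀ᵐ ω ∂Q, ∀ N, P ω (window N) < ∞ :=
  ae_all_iff.2 fun N => hP.ae_apply_lt_top (measurableSet_window N)
    (intensityMeasure_window_lt_top N).ne

variable [IsProbabilityMeasure Q]

/-- `E[1_A P(C)] = Q(A) μ(C)` for `A` in the past of `C`. -/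
theorem IsPoissonMeasure.setLIntegral_apply {μ : Measure Pt}
    (hP : IsPoissonMeasure P μ Q) {a : ℝ≥0} {A : Set Ω}
    (hA : MeasurableSet[poissonFiltration P hP.measurable a] A)
    {C : Set Pt} (hC : MeasurableSet C) (hCa : C ⊆ Ioi a ×ˢ univ) (hμC : μ C ≠ ∞) :
    ∫⁻ ω in A, P ω C ∂Q = Q A * μ C := by
  have hA' : MeasurableSet A := (poissonFiltration P hP.measurable).le a _ hA
  have hdisj : Disjoint C (Ioc 0 a ×ˢ univ) := by
    rw [Set.disjoint_left]
    intro z hz hz'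
    exact absurd hz'.1.2 (not_le.2 (hCa hz).1)
  have hind := hP.indep_iSup_comap hC hdisj
  have hAm : Measurable[poissonFiltration P hP.measurable a]
      (A.indicator fun _ => (1 : ℝ≥0∞)) := measurable_const.indicator hA
  have hprod := lintegral_mul_eq_lintegral_mul_lintegral_of_independent_measurableSpace
    (f := A.indicator fun _ => (1 : ℝ≥0∞)) (g := fun ω => P ω C)
    ((poissonFiltration P hP.measurable).le a)
    ((Measure.measurable_coe hC).comp hP.measurable).comap_le hind
    hAm (comap_measurable _)
  rw [← lintegral_indicator hA', ← hP.lintegral_apply hC hμC, ← lintegral_indicator_one hA']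
  refine Eq.trans ?_ hprod
  refine lintegral_congr fun ω => ?_
  by_cases hω : ω ∈ A <;> simp [hω]

/-- Both sides integrate `H` against measures on (predictable) ⊗ (Borel), namely the images under
`regroup` of Q(dω)P(ω,dz) and of Q times the intensity. Restriction to a window makes them finite,
so it suffices to compare them on the generating rectangles. -/
theorem IsPoissonMeasure.lintegral_window (hP : IsPoissonMeasure P (intensityMeasure ν) Q)
    {H : ℝ≥0 × Ω → ℝ≥0 × ℝ → ℝ≥0∞}
    (hH : @Measurable _ _ (@Prod.instMeasurableSpace _ _
      (poissonFiltration P hP.measurable).predictable inferInstance) _ (Function.uncurry H))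
    (N : ℕ) :
    AEMeasurable (fun ω => ∫⁻ z in window N, H (z.1, ω) z.2 ∂P ω) Q ∧
      ∫⁻ ω, ∫⁻ z in window N, H (z.1, ω) z.2 ∂P ω ∂Q =
        ∫⁻ ω, ∫⁻ z in window N, H (z.1, ω) z.2 ∂intensityMeasure ν ∂Q := by
  set ℱ := poissonFiltration P hP.measurable
  obtain ⟨κ, hκs, hκ⟩ := exists_kernel_eq_restrict (P := P) (measurableSet_window N)
    measurableSet_window iUnion_window
    (fun A hA _ => (Measure.measurable_coe hA).comp hP.measurable)
  have hκae : ∀ᵐ ω ∂Q, κ ω = (P ω).restrict (window N) := by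
    filter_upwards [hP.ae_window_lt_top] with ω hω
    exact hκ ω fun n => (measure_mono inter_subset_right).trans_lt (hω n)
  have hHm : Measurable fun p : Ω × Pt => H (p.2.1, p.1) p.2.2 :=
    @Measurable.comp _ _ _ _ (@Prod.instMeasurableSpace _ _ ℱ.predictable inferInstance) _ _ _
      hH (measurable_regroup ℱ)
  have hfin : IsFiniteMeasure ((intensityMeasure ν).restrict (window N)) :=
    ⟨by rw [Measure.restrict_apply_univ]; exact intensityMeasure_window_lt_top N⟩
  have hrect : ∀ (A : Set Ω) (D : Set Pt), MeasurableSet A → MeasurableSet D →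
      (Q ⊗ₘ κ) (A ×ˢ D) = ∫⁻ ω in A, P ω (D ∩ window N) ∂Q := fun A D hA hD => by
    rw [Measure.compProd_apply_prod hA hD]
    refine lintegral_congr_ae (ae_restrict_of_ae (hκae.mono fun ω hω => ?_))
    simp only [hω, Measure.restrict_apply hD]
  let m₁ := @Measure.map _ _ _
    (@Prod.instMeasurableSpace _ _ ℱ.predictable inferInstance) regroup (Q ⊗ₘ κ)
  let m₂ := @Measure.map _ _ _
    (@Prod.instMeasurableSpace _ _ ℱ.predictable inferInstance) regroup
      (Q.prod ((intensityMeasure ν).restrict (window N)))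
  have hunivQ : (Q ⊗ₘ κ) univ = (Q.prod ((intensityMeasure ν).restrict (window N))) univ := by
    rw [← univ_prod_univ, hrect _ _ MeasurableSet.univ MeasurableSet.univ, Measure.prod_prod,
      Measure.restrict_apply_univ, univ_inter, Measure.restrict_univ,
      hP.lintegral_apply (measurableSet_window N) (intensityMeasure_window_lt_top N).ne,
      measure_univ, one_mul]
  have hfin1 : IsFiniteMeasure (Q ⊗ₘ κ) := ⟨by rw [hunivQ]; exact measure_lt_top _ _⟩
  have hm : m₁ = m₂ := by
    refine @ext_of_generateFrom_prod _ _ ℱ.predictable _ (predictableRect ℱ) rfl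
      (isPiSystem_predictableRect ℱ) (isCountablySpanning_predictableRect ℱ) m₁ m₂
      (@Measure.isFiniteMeasure_map _ _
        (@Prod.instMeasurableSpace _ _ ℱ.predictable inferInstance) _ (Q ⊗ₘ κ) _ _) ?_ ?_
    · rintro s hs B hB
      have hsm : MeasurableSet[ℱ.predictable] s := MeasurableSpace.measurableSet_generateFrom hs
      have hsB : @MeasurableSet _ (@Prod.instMeasurableSpace _ _ ℱ.predictable inferInstance)
          (s ×ˢ B) := @MeasurableSet.prod _ _ ℱ.predictable _ _ _ hsm hB
      rw [@Measure.map_apply _ _ _ (@Prod.instMeasurableSpace _ _ ℱ.predictable inferInstance)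
          _ _ (measurable_regroup ℱ) _ hsB,
        @Measure.map_apply _ _ _ (@Prod.instMeasurableSpace _ _ ℱ.predictable inferInstance)
          _ _ (measurable_regroup ℱ) _ hsB]
      have hpre : ∀ (I : Set ℝ≥0) (A : Set Ω),
          regroup ⁻¹' ((I ×ˢ A) ×ˢ B) = A ×ˢ (I ×ˢ B : Set Pt) := fun I A => by
        ext ⟨ω, x, y⟩
        simp only [regroup, mem_preimage, mem_prod]
        tauto
      -- At time 0 both measures vanish, since the intensity does not charge a single time. For (a,
      -- ∞) × A the event A belongs to the past of time a, and independence factors the expectation.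
      rcases hs with ⟨A, hA, rfl⟩ | ⟨a, A, hA, rfl⟩
      · have hA' := ℱ.le _ _ hA
        have hD : MeasurableSet (({⊥} : Set ℝ≥0) ×ˢ B) := (measurableSet_singleton _).prod hB
        rw [hpre, hrect _ _ hA' hD, Measure.prod_prod, Measure.restrict_apply hD]
        have h0 : intensityMeasure ν (({⊥} : Set ℝ≥0) ×ˢ B ∩ window N) = 0 :=
          measure_mono_null inter_subset_left (intensityMeasure_singleton_prod _ _)
        rw [h0, mul_zero]
        refine le_antisymm ((setLIntegral_le_lintegral _ _).trans ?_) bot_le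
        rw [hP.lintegral_apply (hD.inter (measurableSet_window N)) (by rw [h0]; simp), h0]
      · have hA' := ℱ.le _ _ hA
        have hD : MeasurableSet (Ioi a ×ˢ B) := measurableSet_Ioi.prod hB
        rw [hpre, hrect _ _ hA' hD, Measure.prod_prod, Measure.restrict_apply hD,
          hP.setLIntegral_apply hA (hD.inter (measurableSet_window N))
            (inter_subset_left.trans (prod_mono subset_rfl (subset_univ _)))
            ((measure_mono inter_subset_right).trans_lt
              (intensityMeasure_window_lt_top N)).ne]
    · rw [@Measure.map_apply _ _ _ (@Prod.instMeasurableSpace _ _ ℱ.predictable inferInstance)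
          _ _ (measurable_regroup ℱ) _ MeasurableSet.univ,
        @Measure.map_apply _ _ _ (@Prod.instMeasurableSpace _ _ ℱ.predictable inferInstance)
          _ _ (measurable_regroup ℱ) _ MeasurableSet.univ, preimage_univ, hunivQ]
  have hae : (fun ω => ∫⁻ z, H (z.1, ω) z.2 ∂κ ω) =ᵐ[Q]
      fun ω => ∫⁻ z in window N, H (z.1, ω) z.2 ∂P ω :=
    hκae.mono fun ω hω => by simp only [hω]
  -- Only a.e. measurability is available: the kernel agrees with `P` outside a null set.
  refine ⟨⟨_, hHm.lintegral_kernel_prod_right', hae.symm⟩, ?_⟩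
  rw [← lintegral_congr_ae hae, ← Measure.lintegral_compProd hHm,
    ← lintegral_prod _ hHm.aemeasurable]
  have e1 := @lintegral_map _ _ _ (@Prod.instMeasurableSpace _ _ ℱ.predictable inferInstance)
    (Q ⊗ₘ κ) _ _ hH (measurable_regroup ℱ)
  have e2 := @lintegral_map _ _ _ (@Prod.instMeasurableSpace _ _ ℱ.predictable inferInstance)
    (Q.prod ((intensityMeasure ν).restrict (window N))) _ _ hH (measurable_regroup ℱ)
  change @lintegral _ (@Prod.instMeasurableSpace _ _ ℱ.predictable inferInstance) m₁ _ = _ at e1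
  change @lintegral _ (@Prod.instMeasurableSpace _ _ ℱ.predictable inferInstance) m₂ _ = _ at e2
  rw [hm, e2] at e1
  exact e1.symm

/-- The compensation formula: for `H` predictable in time and chance,
`E ∫ H dP = E ∫ H ds dθ ν(dy)`. -/
theorem IsPoissonMeasure.lintegral_predictable (hP : IsPoissonMeasure P (intensityMeasure ν) Q)
    {H : ℝ≥0 × Ω → ℝ≥0 × ℝ → ℝ≥0∞}
    (hH : @Measurable _ _ (@Prod.instMeasurableSpace _ _
      (poissonFiltration P hP.measurable).predictable inferInstance) _ (Function.uncurry H)) :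
    AEMeasurable (fun ω => ∫⁻ z, H (z.1, ω) z.2 ∂P ω) Q ∧
      ∫⁻ ω, ∫⁻ z, H (z.1, ω) z.2 ∂P ω ∂Q =
        ∫⁻ ω, ∫⁻ z, H (z.1, ω) z.2 ∂intensityMeasure ν ∂Q := by
  have hsup : ∀ (m : Measure Pt) (f : Pt → ℝ≥0∞),
      ∫⁻ z, f z ∂m = ⨆ N, ∫⁻ z in window N, f z ∂m := fun m f => by
    rw [← setLIntegral_iUnion_of_directed _ window_mono.directed_le, iUnion_window,
      Measure.restrict_univ]
  have hHm : Measurable fun p : Ω × Pt => H (p.2.1, p.1) p.2.2 :=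
    @Measurable.comp _ _ _ _ (@Prod.instMeasurableSpace _ _
      (poissonFiltration P hP.measurable).predictable inferInstance) _ _ _
      hH (measurable_regroup (poissonFiltration P hP.measurable))
  have hmono : ∀ m : Ω → Measure Pt, ∀ᵐ ω ∂Q,
      Monotone fun N => ∫⁻ z in window N, H (z.1, ω) z.2 ∂m ω := fun m =>
    ae_of_all _ fun ω i j hij => lintegral_mono_set (window_mono hij)
  constructor
  · rw [funext fun ω => hsup (P ω) _]
    exact AEMeasurable.iSup fun N => (hP.lintegral_window hH N).1
  · rw [lintegral_congr fun ω => hsup (P ω) _,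
      lintegral_congr fun ω => hsup (intensityMeasure ν) fun z => H (z.1, ω) z.2,
      lintegral_iSup' (fun N => (hP.lintegral_window hH N).1) (hmono _),
      lintegral_iSup' (fun N => ?_) (hmono fun _ => intensityMeasure ν)]
    · exact iSup_congr fun N => (hP.lintegral_window hH N).2
    · exact hHm.lintegral_prod_right'.aemeasurable

end Compensation

/-! ### Translations and reflections of integrals, and a Volterra inequality. -/

section Volterra

theorem setLIntegral_comp_sub_left (f : ℝ → ℝ≥0∞) (a b c : ℝ) :
    ∫⁻ x in Ico a b, f (c - x) = ∫⁻ x in Ioc (c - b) (c - a), f x := by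
  rw [← (Measure.measurePreserving_sub_left volume c).setLIntegral_comp_preimage_emb
    (MeasurableEquiv.subLeft c).measurableEmbedding f]
  congr 2
  ext x
  simp only [mem_Ico, mem_preimage, mem_Ioc]
  constructor <;> rintro ⟨h1, h2⟩ <;> constructor <;> linarith

theorem setLIntegral_Ioc_comp_sub_right (f : ℝ → ℝ≥0∞) (a b c : ℝ) :
    ∫⁻ x in Ioc a b, f (x - c) = ∫⁻ x in Ioc (a - c) (b - c), f x := by
  rw [← (measurePreserving_sub_right volume c).setLIntegral_comp_preimage_emb
    (MeasurableEquiv.subRight c).measurableEmbedding f]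
  congr 2
  ext x
  simp

theorem setLIntegral_Iio_lebesgueNN (f : ℝ → ℝ≥0∞) (t : ℝ≥0) :
    ∫⁻ s in Iio t, f s ∂lebesgueNN = ∫⁻ x in Ico 0 (t : ℝ), f x := by
  have : Iio t = (↑) ⁻¹' Ico 0 (t : ℝ) := by ext; simp
  rw [this, setLIntegral_lebesgueNN measurableSet_Ico Ico_subset_Ici_self]

theorem setLIntegral_Ioc_lebesgueNN (f : ℝ → ℝ≥0∞) (a b : ℝ≥0) :
    ∫⁻ s in Ioc a b, f s ∂lebesgueNN = ∫⁻ x in Ioc (a : ℝ) b, f x := by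
  have h0 : Ioc (a : ℝ) b ⊆ Ici 0 := fun x hx => a.2.trans hx.1.le
  have : Ioc a b = (↑) ⁻¹' Ioc (a : ℝ) b := by ext; simp
  rw [this, setLIntegral_lebesgueNN measurableSet_Ioc h0]

/-- A linear Volterra inequality with a kernel of mass less than one: an integrable `v` with
`v ≤ g + k * v` is bounded by `B` as soon as `g + ρ B ≤ B`. -/
theorem le_of_le_add_convolution {T : ℝ≥0} {k : ℝ → ℝ≥0∞} (hk : Measurable k) {v : ℝ≥0 → ℝ≥0∞}
    (hv : Measurable v) {g B ρ : ℝ≥0∞} (hkρ : ∫⁻ x in Ioc 0 (T : ℝ), k x ≤ ρ) (hρ : ρ < 1)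
    (hB : g + ρ * B ≤ B) (hvT : ∫⁻ s in Iic T, v s ∂lebesgueNN ≠ ∞)
    (hvk : ∀ t ≤ T, v t ≤ g + ∫⁻ s in Iio t, k (t - s) * v s ∂lebesgueNN) :
    ∀ t ≤ T, v t ≤ B := by
  -- The excess over `B`, by truncated subtraction. As `g + ρ * B ≤ B`, the source term is absorbed
  -- and the excess satisfies w ≤ k * w.
  let w : ℝ≥0 → ℝ≥0∞ := fun t => v t - B
  have hw : Measurable w := hv.sub measurable_const
  have hkm : Measurable fun p : ℝ≥0 × ℝ≥0 => k (p.1 - p.2) := hk.comp (by fun_prop)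
  have hkt : ∀ t : ℝ≥0, Measurable fun s : ℝ≥0 => k (t - s) := fun t => hk.comp (by fun_prop)
  have hmass : ∀ t ≤ T, ∫⁻ s in Iio t, k (t - s) ∂lebesgueNN ≤ ρ := fun t ht => by
    rw [setLIntegral_Iio_lebesgueNN (fun s => k (t - s)), setLIntegral_comp_sub_left]
    refine (lintegral_mono_set (Ioc_subset_Ioc (by simp) ?_)).trans hkρ
    simpa using ht
  have hwk : ∀ t ≤ T, w t ≤ ∫⁻ s in Iio t, k (t - s) * w s ∂lebesgueNN := fun t ht => by
    refine tsub_le_iff_left.2 ((hvk t ht).trans ?_)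
    calc g + ∫⁻ s in Iio t, k (t - s) * v s ∂lebesgueNN
        ≤ g + ∫⁻ s in Iio t, (k (t - s) * B + k (t - s) * w s) ∂lebesgueNN := by
          gcongr with s
          rw [← mul_add]
          gcongr
          exact le_add_tsub
      _ = g + ((∫⁻ s in Iio t, k (t - s) ∂lebesgueNN) * B
            + ∫⁻ s in Iio t, k (t - s) * w s ∂lebesgueNN) := by
          rw [lintegral_add_left ((hkt t).mul_const B), lintegral_mul_const _ (hkt t)]
      _ ≤ g + (ρ * B + ∫⁻ s in Iio t, k (t - s) * w s ∂lebesgueNN) := by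
          gcongr
          exact hmass t ht
      _ ≤ B + ∫⁻ s in Iio t, k (t - s) * w s ∂lebesgueNN := by
          rw [← add_assoc]
          gcongr
  set I := ∫⁻ s in Iic T, w s ∂lebesgueNN
  have hI : I ≠ ∞ := ne_top_of_le_ne_top hvT (lintegral_mono fun s => tsub_le_self)
  -- Tonelli: the mass of a convolution is at most the product of the masses. With `I` finite and `ρ
  -- < 1` this forces `I = 0`.
  have hIρ : I ≤ ρ * I := by
    calc I ≤ ∫⁻ t in Iic T, ∫⁻ s in Iic T, (Iio t).indicator (fun s => k (t - s) * w s) s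
              ∂lebesgueNN ∂lebesgueNN := by
          refine setLIntegral_mono' measurableSet_Iic fun t ht => (hwk t ht).trans_eq ?_
          rw [lintegral_indicator measurableSet_Iio, Measure.restrict_restrict measurableSet_Iio,
            inter_eq_left.2 fun s (hs : s ∈ Iio t) => mem_Iic.2 (hs.le.trans ht)]
      _ = ∫⁻ s in Iic T, ∫⁻ t in Iic T, (Iio t).indicator (fun s => k (t - s) * w s) s
              ∂lebesgueNN ∂lebesgueNN := by
          refine lintegral_lintegral_swap (Measurable.aemeasurable ?_)
          have h1 : MeasurableSet {p : ℝ≥0 × ℝ≥0 | p.2 < p.1} :=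
            measurableSet_lt measurable_snd measurable_fst
          exact (hkm.mul (hw.comp measurable_snd)).indicator h1
      _ ≤ ∫⁻ s in Iic T, ρ * w s ∂lebesgueNN := by
          refine setLIntegral_mono' measurableSet_Iic fun s _ => ?_
          have h2 : ∀ t : ℝ≥0, (Iio t).indicator (fun s => k (t - s) * w s) s =
              (Ioi s).indicator (fun t : ℝ≥0 => k (t - s)) t * w s := fun t => by
            by_cases hst : s < t <;> simp [hst]
          simp only [h2]
          have h3 : Measurable fun t : ℝ≥0 => k (t - s) := hk.comp (by fun_prop)
          rw [lintegral_mul_const _ (h3.indicator measurableSet_Ioi),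
            lintegral_indicator measurableSet_Ioi, Measure.restrict_restrict measurableSet_Ioi,
            Ioi_inter_Iic, setLIntegral_Ioc_lebesgueNN (fun t => k (t - s)),
            setLIntegral_Ioc_comp_sub_right]
          gcongr
          refine (lintegral_mono_set (Ioc_subset_Ioc (by simp) ?_)).trans hkρ
          simp
      _ = ρ * I := lintegral_const_mul _ hw
  have hI0 : I = 0 := by
    by_contra h0
    refine absurd hIρ (not_le.2 ?_)
    calc ρ * I < 1 * I := (ENNReal.mul_lt_mul_iff_left h0 hI).2 hρ
      _ = I := one_mul I
  have hae : ∀ᵐ s ∂lebesgueNN.restrict (Iic T), w s = 0 := (lintegral_eq_zero_iff hw).1 hI0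
  intro t ht
  -- From almost every to every time: w(t) is bounded by an integral of w, which vanishes.
  have h0 : w t ≤ 0 := by
    refine (hwk t ht).trans_eq ?_
    refine (lintegral_eq_zero_iff ((hkt t).mul hw)).2 ?_
    filter_upwards [ae_restrict_of_ae_restrict_of_subset
      (fun s (hs : s < t) => hs.le.trans ht : Iio t ⊆ Iic T) hae] with s hs
    simp [hs]
  exact tsub_eq_zero_iff_le.1 (le_antisymm h0 bot_le)

end Volterra

/-! ### The L¹ error of discretising the kernel. -/

section Regularity

variable {h : ℝ → ℝ} {T Δ : ℝ}

theorem lintegral_enorm_eq_ofReal {f : ℝ → ℝ} {c : ℝ} (hc : 0 ≤ c)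
    (hf : IntegrableOn f (Ioc 0 c)) :
    ∫⁻ x in Ioc 0 c, ‖f x‖ₑ = ENNReal.ofReal (∫ x in (0 : ℝ)..c, |f x|) := by
  rw [intervalIntegral.integral_of_le hc, ← ofReal_integral_norm_eq_lintegral_enorm hf]
  rfl

theorem setLIntegral_Ioc_comp_add_right (f : ℝ → ℝ≥0∞) (a b c : ℝ) :
    ∫⁻ x in Ioc a b, f (x + c) = ∫⁻ x in Ioc (a + c) (b + c), f x := by
  simpa using setLIntegral_Ioc_comp_sub_right f a b (-c)

theorem integrableOn_comp_add (hm : Measurable h) (hi : IntegrableOn h (Icc 0 T)) {ε : ℝ}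
    (hε : ε ∈ Icc 0 Δ) : IntegrableOn (fun y => h (y + ε)) (Ioc 0 (T - Δ)) := by
  refine ⟨(hm.comp (by fun_prop)).aestronglyMeasurable, ?_⟩
  rw [hasFiniteIntegral_iff_enorm, setLIntegral_Ioc_comp_add_right fun y => ‖h y‖ₑ]
  refine (lintegral_mono_set ?_).trans_lt hi.2
  intro x hx
  exact ⟨by linarith [hx.1, hε.1], by linarith [hx.2, hε.2]⟩

theorem measurable_gridProj (Δ : ℝ) : Measurable (gridProj Δ) := by
  have h : Measurable fun t : ℝ => ((⌊t / Δ⌋ : ℤ) : ℝ) :=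
    (measurable_from_top (f := fun n : ℤ => (n : ℝ))).comp
      (Int.measurable_floor.comp (measurable_id.div_const Δ))
  exact h.mul_const Δ

/-- The integrand takes finitely many values on a bounded interval, so no integrability of `h` is
needed. -/
theorem integrableOn_comp_gridProj (hm : Measurable h) (hΔ : 0 < Δ) :
    IntegrableOn (fun y => h (gridProj Δ y + Δ)) (Ioc 0 (T - Δ)) := by
  let N := ⌊(T - Δ) / Δ⌋₊
  refine IntegrableOn.of_bound (by simp)
    (hm.comp ((measurable_gridProj Δ).add_const Δ)).aestronglyMeasurable
    (∑ k ∈ Finset.range (N + 1), |h (k * Δ + Δ)|) ?_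
  refine (ae_restrict_iff' measurableSet_Ioc).2 (ae_of_all _ fun y hy => ?_)
  have hy0 : 0 ≤ y / Δ := div_nonneg hy.1.le hΔ.le
  have hg : gridProj Δ y = (⌊y / Δ⌋₊ : ℝ) * Δ := by
    rw [gridProj, natCast_floor_eq_intCast_floor hy0]
  rw [hg]
  refine Finset.single_le_sum (f := fun k : ℕ => |h (k * Δ + Δ)|) (fun _ _ => abs_nonneg _)
    (Finset.mem_range.2 (Nat.lt_succ_of_le (Nat.floor_le_floor ?_)))
  exact div_le_div_of_nonneg_right hy.2 hΔ.le

/-- Twice the L¹ norm of `h` is a bound. It guarantees that the real `sSup` in `constR` is a true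
supremum and not the default value 0. -/
theorem bddAbove_shift (hm : Measurable h) (hi : IntegrableOn h (Icc 0 T)) (hΔ : 0 ≤ Δ)
    (hΔT : Δ ≤ T) :
    BddAbove ((fun ε => ∫ y in (0 : ℝ)..(T - Δ), |h (y + ε) - h y|) '' Icc 0 Δ) := by
  have hfin : ∫⁻ x in Icc 0 T, ‖h x‖ₑ < ∞ := hi.2
  refine ⟨((∫⁻ x in Icc 0 T, ‖h x‖ₑ) + ∫⁻ x in Icc 0 T, ‖h x‖ₑ).toReal, ?_⟩
  rintro _ ⟨ε, hε, rfl⟩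
  have h0 : IntegrableOn h (Ioc 0 (T - Δ)) :=
    hi.mono_set fun x hx => ⟨hx.1.le, by linarith [hx.2]⟩
  refine (ENNReal.ofReal_le_iff_le_toReal (by finiteness)).1 ?_
  refine (lintegral_enorm_eq_ofReal (by linarith)
    ((integrableOn_comp_add hm hi hε).sub h0)).symm.trans_le ?_
  calc _ ≤ ∫⁻ x in Ioc 0 (T - Δ), (‖h (x + ε)‖ₑ + ‖h x‖ₑ) := lintegral_mono fun x => enorm_sub_le
    _ = (∫⁻ x in Ioc 0 (T - Δ), ‖h (x + ε)‖ₑ) + ∫⁻ x in Ioc 0 (T - Δ), ‖h x‖ₑ :=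
        lintegral_add_right _ hm.enorm
    _ ≤ _ := by
        rw [setLIntegral_Ioc_comp_add_right fun y => ‖h y‖ₑ]
        refine add_le_add (lintegral_mono_set fun x hx => ?_) (lintegral_mono_set fun x hx => ?_)
        · exact ⟨by linarith [hx.1, hε.1], by linarith [hx.2, hε.2]⟩
        · exact ⟨hx.1.le, by linarith [hx.2]⟩

theorem constR_nonneg (hΔ : 0 ≤ Δ) (hΔT : Δ ≤ T) : 0 ≤ constR h T Δ := by
  refine add_nonneg (add_nonneg ?_ ?_) ?_
  · exact intervalIntegral.integral_nonneg hΔ fun _ _ => abs_nonneg _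
  · refine Real.sSup_nonneg ?_
    rintro _ ⟨ε, -, rfl⟩
    exact intervalIntegral.integral_nonneg (by linarith) fun _ _ => abs_nonneg _
  · exact intervalIntegral.integral_nonneg (by linarith) fun _ _ => abs_nonneg _

/-- The kernel `h(t - ·)` and its discretisation differ by at most `C_R` in `L¹([0, t))`. -/
theorem lintegral_sub_discretised_kernel_le (hm : Measurable h) (hi : IntegrableOn h (Icc 0 T))
    (hΔ : 0 < Δ) {m : ℕ} {t : ℝ} (ht : m * Δ < t) (ht' : t ≤ (m + 1) * Δ)
    (hmT : (m + 1) * Δ ≤ T) :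
    ∫⁻ s in Ico 0 t, ‖h (t - s) - (Ioc 0 (m * Δ)).indicator
      (fun s => h (((m + 1 : ℝ) - ⌈s / Δ⌉₊) * Δ)) s‖ₑ ≤ ENNReal.ofReal (constR h T Δ) := by
  have hmΔ : 0 ≤ m * Δ := by positivity
  have hΔT : Δ ≤ T := by nlinarith
  -- The offset of t in its bin is the shift that will be compared with the supremum in C_R.
  set ε := t - m * Δ with hεdef
  have hε : ε ∈ Icc 0 Δ := ⟨by linarith, by linarith⟩
  set F : ℝ → ℝ≥0∞ := fun s => ‖h (t - s) - (Ioc 0 (m * Δ)).indicator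
      (fun s => h (((m + 1 : ℝ) - ⌈s / Δ⌉₊) * Δ)) s‖ₑ with hF
  have h0 : IntegrableOn h (Ioc 0 (T - Δ)) :=
    hi.mono_set fun x hx => ⟨hx.1.le, by linarith [hx.2]⟩
  have hsplit : ∫⁻ s in Ico 0 t, F s ≤
      (∫⁻ s in Ico 0 (m * Δ), F s) + ∫⁻ s in Ico (m * Δ) t, F s := by
    rw [← Ico_union_Ico_eq_Ico hmΔ ht.le]
    exact lintegral_union_le _ _ _
  -- In the current bin the discrete kernel is zero, except at the left end, which is discarded by
  -- passing to an open interval.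
  have hlast : ∫⁻ s in Ico (m * Δ) t, F s ≤ ENNReal.ofReal (∫ y in (0 : ℝ)..Δ, |h y|) := by
    rw [← lintegral_enorm_eq_ofReal hΔ.le (hi.mono_set fun x hx => ⟨hx.1.le, hx.2.trans hΔT⟩)]
    calc ∫⁻ s in Ico (m * Δ) t, F s = ∫⁻ s in Ioo (m * Δ) t, F s := by
          rw [restrict_Ioo_eq_restrict_Ico]
      _ = ∫⁻ s in Ioo (m * Δ) t, ‖h (t - s)‖ₑ := by
          refine setLIntegral_congr_fun measurableSet_Ioo fun s hs => ?_
          simp only [hF]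
          rw [indicator_of_notMem (fun hs' => not_lt.2 hs'.2 hs.1), sub_zero]
      _ = ∫⁻ s in Ioc 0 ε, ‖h s‖ₑ := by
          rw [restrict_Ioo_eq_restrict_Ico, setLIntegral_comp_sub_left (fun x => ‖h x‖ₑ), sub_self]
      _ ≤ _ := lintegral_mono_set (Ioc_subset_Ioc_right hε.2)
  -- With y = mΔ - s, the lag t - s is y + ε and the discrete lag is (y)_Δ + Δ; inserting h(y)
  -- between the two values gives the last two terms of C_R.
  have hpast : ∫⁻ s in Ico 0 (m * Δ), F s ≤
      ENNReal.ofReal (∫ y in (0 : ℝ)..(T - Δ), |h (y + ε) - h y|) +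
        ENNReal.ofReal (∫ y in (0 : ℝ)..(T - Δ), |h y - h (gridProj Δ y + Δ)|) := by
    have i1 := lintegral_enorm_eq_ofReal (by linarith) ((integrableOn_comp_add hm hi hε).sub h0)
    have i2 := lintegral_enorm_eq_ofReal (by linarith) (h0.sub (integrableOn_comp_gridProj hm hΔ))
    simp only [Pi.sub_apply] at i1 i2
    rw [← i1, ← i2, ← lintegral_add_left (by fun_prop)]
    calc ∫⁻ s in Ico 0 (m * Δ), F s = ∫⁻ s in Ioo 0 (m * Δ), F s := by
          rw [restrict_Ioo_eq_restrict_Ico]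
      _ ≤ ∫⁻ s in Ioo 0 (m * Δ), (‖h ((m * Δ - s) + ε) - h (m * Δ - s)‖ₑ +
            ‖h (m * Δ - s) - h (gridProj Δ (m * Δ - s) + Δ)‖ₑ) := by
          refine setLIntegral_mono' measurableSet_Ioo fun s hs => ?_
          have e1 : t - s = (m * Δ - s) + ε := by rw [hεdef]; ring
          have e2 : ((m + 1 : ℝ) - ⌈s / Δ⌉₊) * Δ = gridProj Δ (m * Δ - s) + Δ := by
            have hs0 : 0 ≤ s / Δ := div_nonneg hs.1.le hΔ.le
            have e3 : (m * Δ - s) / Δ = -(s / Δ) + (m : ℤ) := by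
              push_cast
              field_simp
              ring
            -- The reflection s ↦ mΔ - s turns the ceiling that indexes bins into the floor in
            -- `gridProj`.
            rw [gridProj, e3, Int.floor_add_intCast, Int.floor_neg,
              natCast_ceil_eq_intCast_ceil hs0]
            push_cast
            ring
          have hs' : s ∈ Ioc 0 (m * Δ) := ⟨hs.1, hs.2.le⟩
          simp only [hF]
          rw [indicator_of_mem hs', e1, e2]
          refine le_trans (le_of_eq ?_) (enorm_add_le _ _)
          congr 1
          ring
      _ = ∫⁻ y in Ioc 0 (m * Δ), (‖h (y + ε) - h y‖ₑ + ‖h y - h (gridProj Δ y + Δ)‖ₑ) := by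
          rw [restrict_Ioo_eq_restrict_Ico, setLIntegral_comp_sub_left (fun y =>
            ‖h (y + ε) - h y‖ₑ + ‖h y - h (gridProj Δ y + Δ)‖ₑ), sub_self, sub_zero]
      _ ≤ _ := lintegral_mono_set (Ioc_subset_Ioc_right (by linarith))
  refine hsplit.trans ((add_le_add hpast hlast).trans ?_)
  have n1 : 0 ≤ ∫ y in (0 : ℝ)..(T - Δ), |h (y + ε) - h y| :=
    intervalIntegral.integral_nonneg (by linarith) fun _ _ => abs_nonneg _
  have n2 : 0 ≤ ∫ y in (0 : ℝ)..(T - Δ), |h y - h (gridProj Δ y + Δ)| :=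
    intervalIntegral.integral_nonneg (by linarith) fun _ _ => abs_nonneg _
  have n3 : 0 ≤ ∫ y in (0 : ℝ)..Δ, |h y| :=
    intervalIntegral.integral_nonneg hΔ.le fun _ _ => abs_nonneg _
  rw [← ENNReal.ofReal_add n1 n2, ← ENNReal.ofReal_add (add_nonneg n1 n2) n3]
  refine ENNReal.ofReal_le_ofReal ?_
  have hsup := le_csSup (bddAbove_shift hm hi hΔ.le hΔT) (mem_image_of_mem _ hε)
  unfold constR
  linarith

end Regularity

/-! ### Compensation of thinned integrals. -/

section Thinning

theorem measurable_thinning {X : Type*} [MeasurableSpace X] {W : X → ℝ≥0∞} (hW : Measurable W)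
    {D : X → Set ℝ≥0} (hD : MeasurableSet {p : X × ℝ≥0 | p.2 ∈ D p.1}) {c : ℝ → ℝ≥0∞}
    (hc : Measurable c) :
    Measurable (Function.uncurry fun (p : X) (q : ℝ≥0 × ℝ) =>
      W p * ((D p).indicator 1 q.1 * c q.2)) := by
  have h1 : Measurable fun r : X × ℝ≥0 × ℝ => (D r.1).indicator (1 : ℝ≥0 → ℝ≥0∞) r.2.1 := by
    have : Measurable ({p : X × ℝ≥0 | p.2 ∈ D p.1}.indicator (1 : X × ℝ≥0 → ℝ≥0∞)) :=
      measurable_one.indicator hD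
    exact this.comp (g := {p : X × ℝ≥0 | p.2 ∈ D p.1}.indicator (1 : X × ℝ≥0 → ℝ≥0∞))
      (f := fun r : X × ℝ≥0 × ℝ => (r.1, r.2.1)) (by fun_prop)
  exact (hW.comp measurable_fst).mul (h1.mul (hc.comp (by fun_prop)))

theorem measurableSet_le_snd {X : Type*} [MeasurableSpace X] {α : X → ℝ} (hα : Measurable α) :
    MeasurableSet {p : X × ℝ≥0 | (p.2 : ℝ) ≤ α p.1} :=
  measurableSet_le (by fun_prop) (hα.comp measurable_fst)

theorem lebesgueNN_le (a : ℝ) : lebesgueNN {θ : ℝ≥0 | (θ : ℝ) ≤ a} = ENNReal.ofReal a := by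
  have : {θ : ℝ≥0 | (θ : ℝ) ≤ a} = (↑) ⁻¹' Icc (0 : ℝ) a := by ext; simp
  rw [this, lebesgueNN_preimage measurableSet_Icc Icc_subset_Ici_self, Real.volume_Icc, sub_zero]

/-- The heights accepted by exactly one of the levels `a` and `a'`. -/
def between (a a' : ℝ) : Set ℝ≥0 := {θ | ¬((θ : ℝ) ≤ a ↔ (θ : ℝ) ≤ a')}

theorem lebesgueNN_between_le (a a' : ℝ) : lebesgueNN (between a a') ≤ ‖a - a'‖ₑ := by
  have hsub : between a a' ⊆ (↑) ⁻¹' (Ici 0 ∩ Ioc (min a a') (max a a')) := by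
    intro θ hθ
    refine ⟨θ.2, ?_⟩
    simp only [between, mem_ofPred_eq] at hθ
    simp only [mem_Ioc, min_lt_iff, le_max_iff]
    by_cases h1 : (θ : ℝ) ≤ a <;> by_cases h2 : (θ : ℝ) ≤ a' <;> simp_all
  refine (measure_mono hsub).trans ?_
  rw [lebesgueNN_preimage (measurableSet_Ici.inter measurableSet_Ioc) inter_subset_left]
  refine (measure_mono inter_subset_right).trans_eq ?_
  rw [Real.volume_Ioc, max_sub_min_eq_abs', Real.enorm_eq_ofReal_abs]

theorem measurableSet_between {X : Type*} [MeasurableSpace X] {α β : X → ℝ} (hα : Measurable α)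
    (hβ : Measurable β) : MeasurableSet {p : X × ℝ≥0 | p.2 ∈ between (α p.1) (β p.1)} := by
  have h1 := measurableSet_le_snd hα
  have h2 := measurableSet_le_snd hβ
  have : {p : X × ℝ≥0 | p.2 ∈ between (α p.1) (β p.1)} =
      symmDiff {p : X × ℝ≥0 | (p.2 : ℝ) ≤ α p.1} {p : X × ℝ≥0 | (p.2 : ℝ) ≤ β p.1} := by
    ext p
    simp only [between, mem_ofPred_eq, Set.mem_symmDiff]
    tauto
  rw [this]
  exact h1.symmDiff h2

variable {ν : Measure ℝ} [IsProbabilityMeasure ν] {Ω : Type*} [MeasurableSpace Ω] {Q : Measure Ω}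
  [IsProbabilityMeasure Q] {P : Ω → Measure Pt}

/-- The compensation formula for thinned integrands. -/
theorem IsPoissonMeasure.lintegral_thinning (hP : IsPoissonMeasure P (intensityMeasure ν) Q)
    {W : ℝ≥0 × Ω → ℝ≥0∞} (hW : Measurable[(poissonFiltration P hP.measurable).predictable] W)
    {D : ℝ≥0 × Ω → Set ℝ≥0}
    (hD : @MeasurableSet _ (@Prod.instMeasurableSpace _ _
      (poissonFiltration P hP.measurable).predictable inferInstance)
      {p : (ℝ≥0 × Ω) × ℝ≥0 | p.2 ∈ D p.1}) {c : ℝ → ℝ≥0∞} (hc : Measurable c) :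
    AEMeasurable (fun ω => ∫⁻ z, W (z.1, ω) * ((D (z.1, ω)).indicator 1 z.2.1 * c z.2.2) ∂P ω)
        Q ∧
      ∫⁻ ω, ∫⁻ z, W (z.1, ω) * ((D (z.1, ω)).indicator 1 z.2.1 * c z.2.2) ∂P ω ∂Q =
        (∫⁻ y, c y ∂ν) * ∫⁻ s, ∫⁻ ω, W (s, ω) * lebesgueNN (D (s, ω)) ∂Q ∂lebesgueNN := by
  set ℱ := poissonFiltration P hP.measurable
  have hH := @measurable_thinning (ℝ≥0 × Ω) ℱ.predictable W hW D hD c hc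
  obtain ⟨h1, h2⟩ := hP.lintegral_predictable hH
  refine ⟨h1, h2.trans ?_⟩
  have hD' : MeasurableSet {p : (ℝ≥0 × Ω) × ℝ≥0 | p.2 ∈ D p.1} := by
    have hle : @Prod.instMeasurableSpace (ℝ≥0 × Ω) ℝ≥0 ℱ.predictable inferInstance ≤
        Prod.instMeasurableSpace :=
          sup_le_sup (MeasurableSpace.comap_mono (predictable_le ℱ)) le_rfl
    exact hle _ hD
  have hW' : Measurable W := hW.mono (predictable_le ℱ) le_rfl
  have hHm := measurable_thinning hW' hD' hc
  have hDs : ∀ p, MeasurableSet (D p) := fun p => measurable_prodMk_left hD'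
  have hleb : Measurable fun p => lebesgueNN (D p) := measurable_measure_prodMk_left hD'
  calc _ = ∫⁻ ω, ∫⁻ s, (∫⁻ y, c y ∂ν) * (W (s, ω) * lebesgueNN (D (s, ω))) ∂lebesgueNN ∂Q := by
        refine lintegral_congr fun ω => ?_
        rw [intensityMeasure, lintegral_prod]
        · refine lintegral_congr fun s => ?_
          have hi : Measurable ((D (s, ω)).indicator (1 : ℝ≥0 → ℝ≥0∞)) :=
            measurable_one.indicator (hDs _)
          have hi2 : Measurable fun q : ℝ≥0 × ℝ => (D (s, ω)).indicator (1 : ℝ≥0 → ℝ≥0∞) q.1 *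
              c q.2 := (hi.comp measurable_fst).mul (hc.comp measurable_snd)
          simp only
          rw [lintegral_const_mul _ hi2, lintegral_prod_mul hi.aemeasurable hc.aemeasurable,
            lintegral_indicator_one (hDs _)]
          ring
        · exact (hHm.comp (f := fun z : Pt => ((z.1, ω), z.2)) (by fun_prop)).aemeasurable
    _ = ∫⁻ s, ∫⁻ ω, (∫⁻ y, c y ∂ν) * (W (s, ω) * lebesgueNN (D (s, ω))) ∂Q ∂lebesgueNN := by
        refine lintegral_lintegral_swap (Measurable.aemeasurable ?_)
        exact ((hW'.mul hleb).comp measurable_swap).const_mul _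
    _ = _ := by
        have hm : Measurable fun p => W p * lebesgueNN (D p) := hW'.mul hleb
        rw [← lintegral_const_mul _ hm.lintegral_prod_right']
        refine lintegral_congr fun s => ?_
        exact lintegral_const_mul _ (hm.comp (by fun_prop : Measurable fun ω => (s, ω)))

end Thinning

/-! ### Examples of predictable processes. -/

section PredictableProcesses

variable {Ω E : Type*} [mΩ : MeasurableSpace Ω] [MeasurableSpace E] {ℱ : Filtration ℝ≥0 mΩ}

theorem measurableSet_predictable_fst {A : Set ℝ≥0} (hA : MeasurableSet A) :
    MeasurableSet[ℱ.predictable] {p : ℝ≥0 × Ω | p.1 ∈ A} := by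
  have hgen := (BorelSpace.measurable_eq (α := ℝ≥0)).trans (borel_eq_generateFrom_Ioi ℝ≥0)
  have h : @Measurable _ _ ℱ.predictable _ (Prod.fst : ℝ≥0 × Ω → ℝ≥0) := by
    rw [hgen]
    refine @measurable_generateFrom _ _ ℱ.predictable _ _ ?_
    rintro _ ⟨a, rfl⟩
    have := measurableSet_predictable_Ioi_prod (𝓕 := ℱ) (i := a) MeasurableSet.univ
    convert this using 1
    ext; simp
  exact h hA

theorem measurable_predictable_fst :
    @Measurable _ _ ℱ.predictable _ (Prod.fst : ℝ≥0 × Ω → ℝ≥0) :=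
  fun _ hA => measurableSet_predictable_fst hA

/-- A process that jumps on the grid `Δℕ` and is predictable there is predictable. -/
theorem measurable_predictable_step {Δ : ℝ≥0} (hΔ : 0 < Δ) {d : ℕ → Ω → E}
    (hd : ∀ n, Measurable[ℱ (((n - 1 : ℕ) : ℝ≥0) * Δ)] (d n)) :
    Measurable[ℱ.predictable] fun p : ℝ≥0 × Ω => d ⌈(p.1 : ℝ) / (Δ : ℝ)⌉₊ p.2 := by
  intro B hB
  have hU : (fun p : ℝ≥0 × Ω => d ⌈(p.1 : ℝ) / (Δ : ℝ)⌉₊ p.2) ⁻¹' B =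
      ⋃ n : ℕ, {p : ℝ≥0 × Ω | ⌈(p.1 : ℝ) / (Δ : ℝ)⌉₊ = n} ∩ univ ×ˢ (d n ⁻¹' B) := by
    ext p; simp
  rw [hU]
  refine MeasurableSet.iUnion fun n => ?_
  have hA : MeasurableSet[ℱ (((n - 1 : ℕ) : ℝ≥0) * Δ)] (d n ⁻¹' B) := hd n hB
  have hΔ' : (0 : ℝ) < Δ := hΔ
  -- The index 0 is reached only at time 0, and 0 - 1 = 0 in ℕ makes `d 0` measurable for the
  -- σ-algebra at time 0, as the generator {0} × A requires. The index n + 1 is the bin (nΔ,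
  -- (n+1)Δ].
  rcases n with _ | n
  · have : {p : ℝ≥0 × Ω | ⌈(p.1 : ℝ) / (Δ : ℝ)⌉₊ = 0} ∩ univ ×ˢ (d 0 ⁻¹' B) =
        {⊥} ×ˢ (d 0 ⁻¹' B) := by
      ext ⟨s, ω⟩
      simp only [Nat.ceil_eq_zero, mem_inter_iff, mem_ofPred_eq, mem_prod, mem_univ, true_and,
        mem_singleton_iff, bot_eq_zero, and_congr_left_iff, div_le_iff₀ hΔ', zero_mul]
      intro _
      exact ⟨fun h => le_antisymm h bot_le, fun h => by simp [h]⟩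
    rw [this]
    rw [zero_tsub, Nat.cast_zero, zero_mul] at hA
    exact measurableSet_predictable_singleton_bot_prod hA
  · have : {p : ℝ≥0 × Ω | ⌈(p.1 : ℝ) / (Δ : ℝ)⌉₊ = n + 1} ∩ univ ×ˢ (d (n + 1) ⁻¹' B) =
        Ioc ((n : ℝ≥0) * Δ) ((n + 1 : ℝ≥0) * Δ) ×ˢ (d (n + 1) ⁻¹' B) := by
      ext ⟨s, ω⟩
      simp only [mem_inter_iff, mem_ofPred_eq, mem_prod, mem_univ, true_and, mem_Ioc,
        and_congr_left_iff, ← NNReal.coe_lt_coe, ← NNReal.coe_le_coe, NNReal.coe_mul,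
        NNReal.coe_add, NNReal.coe_natCast, NNReal.coe_one]
      intro _
      rw [Nat.ceil_eq_iff (by simp), lt_div_iff₀ hΔ', div_le_iff₀ hΔ']
      simp
    rw [this]
    exact measurableSet_predictable_Ioc_prod _ _ (by simpa using hA)

theorem measurable_predictable_indicator_Ioi [Zero E] {a : ℝ≥0} {f : Ω → E}
    (hf : Measurable[ℱ a] f) :
    Measurable[ℱ.predictable] ((Ioi a ×ˢ univ).indicator fun p : ℝ≥0 × Ω => f p.2) := by
  intro B hB
  rw [indicator_preimage]
  have h1 : MeasurableSet[ℱ.predictable] (Ioi a ×ˢ (univ : Set Ω)) :=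
    measurableSet_predictable_Ioi_prod MeasurableSet.univ
  refine MeasurableSet.union ?_ (MeasurableSet.diff (measurable_const hB) h1)
  have h2 := measurableSet_predictable_Ioi_prod (𝓕 := ℱ) (i := a) (hf hB)
  convert h2 using 1
  ext p
  simp [and_comm]

end PredictableProcesses

/-! ### The integrated intensity, used for localisation. -/

section Cumulative

/-- The integral of `f` over `[0, s)`. -/
noncomputable def cumul (f : ℝ≥0 → ℝ≥0∞) (s : ℝ≥0) : ℝ≥0∞ := ∫⁻ r in Iio s, f r ∂lebesgueNN

theorem cumul_mono (f : ℝ≥0 → ℝ≥0∞) : Monotone (cumul f) := fun _ _ h =>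
  lintegral_mono_set (Iio_subset_Iio h)

/-- Left-continuity in countable form. Each term is the indicator of (q, ∞) times a variable known
at time q, hence predictable; so is the supremum. -/
theorem cumul_eq_iSup (f : ℝ≥0 → ℝ≥0∞) (s : ℝ≥0) :
    cumul f s = ⨆ n : ℕ, (Ioi (TopologicalSpace.denseSeq ℝ≥0 n)).indicator
      (fun _ => ∫⁻ r in Iic (TopologicalSpace.denseSeq ℝ≥0 n), f r ∂lebesgueNN) s := by
  classical
  set q := TopologicalSpace.denseSeq ℝ≥0
  let A : ℕ → Set ℝ≥0 := fun n => if q n < s then Iic (q n) else ∅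
  have hA : ⋃ n, A n = Iio s := by
    ext r
    simp only [mem_iUnion, mem_Iio, A]
    constructor
    · rintro ⟨n, hn⟩
      split_ifs at hn with h
      · exact lt_of_le_of_lt hn h
      · exact absurd hn (notMem_empty _)
    · intro hr
      obtain ⟨n, hn⟩ := (TopologicalSpace.denseRange_denseSeq ℝ≥0).exists_mem_open
        (isOpen_Ioo (a := r) (b := s)) (nonempty_Ioo.2 hr)
      exact ⟨n, by rw [if_pos hn.2]; exact hn.1.le⟩
  have hdir : Directed (· ⊆ ·) A := by
    intro i j
    by_cases hi : q i < s
    · by_cases hj : q j < s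
      · rcases le_total (q i) (q j) with h | h
        · exact ⟨j, by simp [A, hi, hj, h], subset_rfl⟩
        · exact ⟨i, subset_rfl, by simp [A, hi, hj, h]⟩
      · exact ⟨i, subset_rfl, by simp [A, hj]⟩
    · exact ⟨j, by simp [A, hi], subset_rfl⟩
  rw [cumul, ← hA, setLIntegral_iUnion_of_directed _ hdir]
  refine iSup_congr fun n => ?_
  by_cases hn : q n < s <;> simp [A, hn]

/-- By monotonicity the times at which `cumul f` has not exceeded `n` form an initial interval.
Left-continuity keeps the bound at its supremum σ, and the single point σ carries no mass. -/
theorem lintegral_indicator_cumul_le (f : ℝ≥0 → ℝ≥0∞) (T : ℝ≥0) (n : ℝ≥0∞) :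
    ∫⁻ s in Iic T, {s | cumul f s ≤ n}.indicator f s ∂lebesgueNN ≤ n := by
  let S : Set ℝ≥0 := Iic T ∩ {s | cumul f s ≤ n}
  have hS0 : S.Nonempty := ⟨0, mem_Iic.2 zero_le, by simp [cumul]⟩
  have hSb : BddAbove S := ⟨T, fun s hs => hs.1⟩
  set σ := sSup S
  have hσ : cumul f σ ≤ n := by
    rw [cumul_eq_iSup]
    refine iSup_le fun j => ?_
    by_cases hj : TopologicalSpace.denseSeq ℝ≥0 j < σ
    · obtain ⟨s, hs, hjs⟩ := exists_lt_of_lt_csSup hS0 hj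
      rw [indicator_of_mem (mem_Ioi.2 hj)]
      exact (lintegral_mono_set fun r hr => lt_of_le_of_lt hr hjs).trans hs.2
    · rw [indicator_of_notMem (by simpa using hj)]
      exact bot_le
  calc ∫⁻ s in Iic T, {s | cumul f s ≤ n}.indicator f s ∂lebesgueNN
      = ∫⁻ s, (Iic T).indicator ({s | cumul f s ≤ n}.indicator f) s ∂lebesgueNN := by
        rw [lintegral_indicator measurableSet_Iic]
    _ ≤ ∫⁻ s, (Iic σ).indicator f s ∂lebesgueNN := by
        refine lintegral_mono fun s => ?_
        rw [indicator_indicator]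
        exact indicator_le_indicator_of_subset (fun s hs => le_csSup hSb hs) (fun _ => bot_le) s
    _ = ∫⁻ s in Iio σ, f s ∂lebesgueNN := by
        rw [lintegral_indicator measurableSet_Iic, restrict_Iio_eq_restrict_Iic]
    _ ≤ n := hσ

variable {Ω : Type*} [mΩ : MeasurableSpace Ω] {ℱ : Filtration ℝ≥0 mΩ} {lam : ℝ≥0 → Ω → ℝ}

/-- Predictable processes are progressive: on [0, q] the process is jointly measurable with respect
to the past of q, and Tonelli applies there. -/
theorem measurable_lintegral_Iic (hlam : IsStronglyPredictable ℱ lam) (q : ℝ≥0) :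
    Measurable[ℱ q] fun ω => ∫⁻ r in Iic q, ENNReal.ofReal (lam r ω) ∂lebesgueNN := by
  have h1 := hlam.isStronglyProgressive q
  have h2 : @Measurable _ _ (@Prod.instMeasurableSpace _ _ _ (ℱ q)) _
      fun p : Iic q × Ω => ENNReal.ofReal (lam p.1 p.2) :=
    ENNReal.measurable_ofReal.comp h1.measurable
  have h3 : (fun ω => ∫⁻ r in Iic q, ENNReal.ofReal (lam r ω) ∂lebesgueNN) = fun ω =>
      ∫⁻ r : Iic q, ENNReal.ofReal (lam r ω) ∂(lebesgueNN.comap (↑)) := by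
    funext ω
    rw [lintegral_subtype_comap measurableSet_Iic fun r => ENNReal.ofReal (lam r ω)]
  rw [h3]
  have : SFinite (lebesgueNN.comap ((↑) : Iic q → ℝ≥0)) := by
    have : IsFiniteMeasure (lebesgueNN.comap ((↑) : Iic q → ℝ≥0)) := ⟨by
      rw [comap_subtype_coe_apply measurableSet_Iic, image_univ, Subtype.range_coe,
        lebesgueNN_Iic]
      exact ENNReal.coe_lt_top⟩
    infer_instance
  exact @Measurable.lintegral_prod_left' _ _ _ (ℱ q) _ _ _ h2

theorem measurable_cumul (hlam : IsStronglyPredictable ℱ lam) :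
    Measurable[ℱ.predictable] fun p : ℝ≥0 × Ω =>
      cumul (fun r => ENNReal.ofReal (lam r p.2)) p.1 := by
  simp only [cumul_eq_iSup]
  refine Measurable.iSup fun n => ?_
  have := measurable_predictable_indicator_Ioi
    (measurable_lintegral_Iic hlam (TopologicalSpace.denseSeq ℝ≥0 n))
  convert this using 2 with p
  by_cases hp : TopologicalSpace.denseSeq ℝ≥0 n < p.1 <;> simp [indicator, hp]

end Cumulative

/-! ### The mean of the continuous-time intensity. -/

section Intensity

variable {L : ℝ≥0} {ψ : ℝ → ℝ}

theorem ofReal_lipschitz_le (hψ : LipschitzWith L ψ) (x : ℝ) :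
    ENNReal.ofReal (ψ x) ≤ ENNReal.ofReal (ψ 0) + L * ‖x‖ₑ := by
  have h1 : ψ x ≤ ψ 0 + L * |x| := by
    have := hψ.dist_le_mul x 0
    rw [Real.dist_eq, Real.dist_eq, sub_zero] at this
    linarith [le_abs_self (ψ x - ψ 0)]
  refine (ENNReal.ofReal_le_ofReal h1).trans (ENNReal.ofReal_add_le.trans ?_)
  rw [ENNReal.ofReal_mul L.coe_nonneg, Real.enorm_eq_ofReal_abs]
  gcongr
  exact (ENNReal.ofReal_coe_nnreal).le

variable {b h : ℝ → ℝ} {T : ℝ≥0}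
  {Ω : Type*} [MeasurableSpace Ω] {Q : Measure Ω} {P : Ω → Measure Pt} {R lam : ℝ≥0 → Ω → ℝ}

theorem IsHawkes.measurable_predictable {hP : Measurable P} (hH : IsHawkes Q P hP T h ψ b R lam) :
    Measurable[(poissonFiltration P hP).predictable] (Function.uncurry lam) :=
  hH.predictable.measurable

theorem IsHawkes.measurable_intensity {hP : Measurable P} (hH : IsHawkes Q P hP T h ψ b R lam) :
    Measurable (Function.uncurry lam) :=
  hH.measurable_predictable.mono (predictable_le _) le_rfl

/-- Stated with a lower integral, the bound holds before the integrand is known to be integrable,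
hence before any moment of the intensity is available. -/
theorem IsHawkes.ofReal_intensity_le (hψ : LipschitzWith L ψ)
    {hP : Measurable P} (hH : IsHawkes Q P hP T h ψ b R lam) :
    ∀ᵐ ω ∂Q, ∀ t ≤ T, ENNReal.ofReal (lam t ω) ≤ ENNReal.ofReal (ψ 0) +
      L * ∫⁻ z, (Iio t).indicator (fun s : ℝ≥0 => ‖h (t - s)‖ₑ) z.1 *
        ({θ : ℝ≥0 | (θ : ℝ) ≤ lam z.1 ω}.indicator 1 z.2.1 * ‖b z.2.2‖ₑ) ∂P ω := by
  filter_upwards [hH.intensity_eq] with ω hω t ht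
  rw [hω t ⟨bot_le, ht⟩]
  refine (ofReal_lipschitz_le hψ _).trans ?_
  gcongr
  refine (enorm_integral_le_lintegral_enorm _).trans ?_
  rw [← lintegral_indicator (measurableSet_Ico.prod MeasurableSet.univ)]
  refine lintegral_mono fun z => le_of_eq ?_
  by_cases h1 : z.1 < t
  · by_cases h2 : (z.2.1 : ℝ) ≤ lam z.1 ω <;>
      simp [indicator, under, h1, h2, enorm_mul]
  · simp [indicator, h1]

variable {ν : Measure ℝ} [IsProbabilityMeasure ν] [IsProbabilityMeasure Q]
  {hP : IsPoissonMeasure P (intensityMeasure ν) Q}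

/-- The expected intensity is bounded by every `B` with `ψ(0) + ρ_h B ≤ B`. -/
theorem IsHawkes.lintegral_intensity_le (hψ : LipschitzWith L ψ) (hb : Measurable b)
    (hh : Measurable h) (hH : IsHawkes Q P hP.measurable T h ψ b R lam) {ρ B : ℝ≥0∞}
    (hρ : ∫⁻ x in Ioc 0 (T : ℝ), L * (∫⁻ y, ‖b y‖ₑ ∂ν) * ‖h x‖ₑ ≤ ρ) (hρ1 : ρ < 1)
    (hB : ENNReal.ofReal (ψ 0) + ρ * B ≤ B) {t : ℝ≥0} (ht : t ≤ T) :
    ∫⁻ ω, ENNReal.ofReal (lam t ω) ∂Q ≤ B := by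
  set ℱ := poissonFiltration P hP.measurable
  -- localisation by the integrated intensity, which is finite but not known to be integrable
  let C : ℝ≥0 × Ω → ℝ≥0∞ := fun p => cumul (fun r => ENNReal.ofReal (lam r p.2)) p.1
  have hC : Measurable[ℱ.predictable] C := measurable_cumul hH.predictable
  -- This cutoff is predictable and nonincreasing in time, so the cutoff at t can be replaced by the
  -- larger one at s < t inside the integral over the past.
  let G : ℕ → ℝ≥0 × Ω → ℝ≥0∞ := fun n => {p | C p ≤ n}.indicator 1
  have hG : ∀ n, Measurable[ℱ.predictable] (G n) := fun n =>
    (@measurable_const ℝ≥0∞ (ℝ≥0 × Ω) _ ℱ.predictable 1).indicator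
      (measurableSet_le hC measurable_const)
  have hGm : ∀ n, Measurable (G n) := fun n => (hG n).mono (predictable_le ℱ) le_rfl
  have hG1 : ∀ n p, G n p ≤ 1 := fun n p => indicator_le_self' (fun _ _ => bot_le) p
  have hGanti : ∀ n ω s t, s ≤ t → G n (t, ω) ≤ G n (s, ω) := fun n ω s t hst => by
    by_cases h1 : C (t, ω) ≤ n
    · have h2 : C (s, ω) ≤ n := (cumul_mono _ hst).trans h1
      simp [G, h1, h2]
    · simp [G, h1]
  have hlam : Measurable fun p : ℝ≥0 × Ω => ENNReal.ofReal (lam p.1 p.2) :=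
    ENNReal.measurable_ofReal.comp hH.measurable_intensity
  let u : ℕ → ℝ≥0 → ℝ≥0∞ := fun n t => ∫⁻ ω, G n (t, ω) * ENNReal.ofReal (lam t ω) ∂Q
  have hum : ∀ n, Measurable (u n) := fun n => ((hGm n).mul hlam).lintegral_prod_right'
  -- The cutoff bounds the integral of each path by `n`, which supplies the integrability needed for
  -- the Volterra inequality.
  have hufin : ∀ n, ∫⁻ s in Iic T, u n s ∂lebesgueNN ≠ ∞ := fun n => by
    refine ne_top_of_le_ne_top (ENNReal.natCast_ne_top n) ?_
    rw [lintegral_lintegral_swap ((hGm n).mul hlam).aemeasurable]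
    calc _ ≤ ∫⁻ ω, (n : ℝ≥0∞) ∂Q := lintegral_mono fun ω => by
          refine le_trans (le_of_eq (lintegral_congr fun s => ?_))
            (lintegral_indicator_cumul_le (fun r => ENNReal.ofReal (lam r ω)) T n)
          by_cases h1 : C (s, ω) ≤ n
          · have h1' := h1
            simp only [C] at h1'
            simp [G, h1, h1']
          · have h1' := h1
            simp only [C] at h1'
            simp [G, h1, h1']
      _ = n := by simp
  have hrec : ∀ n, ∀ t ≤ T, u n t ≤ ENNReal.ofReal (ψ 0) +
      ∫⁻ s in Iio t, L * (∫⁻ y, ‖b y‖ₑ ∂ν) * ‖h (t - s)‖ₑ * u n s ∂lebesgueNN := fun n t ht => by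
    let W : ℝ≥0 × Ω → ℝ≥0∞ := fun p =>
      (Iio t).indicator (fun s : ℝ≥0 => ‖h (t - s)‖ₑ) p.1 * G n p
    have hk : Measurable ((Iio t).indicator fun s : ℝ≥0 => ‖h (t - s)‖ₑ) :=
      (hh.comp (by fun_prop : Measurable fun s : ℝ≥0 => (t : ℝ) - s)).enorm.indicator
        measurableSet_Iio
    have hW : Measurable[ℱ.predictable] W :=
      (hk.comp measurable_predictable_fst).fun_mul (hG n)
    obtain ⟨hae, heq⟩ := hP.lintegral_thinning hW
      (D := fun p => {θ : ℝ≥0 | (θ : ℝ) ≤ lam p.1 p.2})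
      (@measurableSet_le_snd _ ℱ.predictable _ hH.measurable_predictable) hb.enorm
    calc u n t ≤ ∫⁻ ω, (ENNReal.ofReal (ψ 0) + L * ∫⁻ z, W (z.1, ω) *
            ({θ : ℝ≥0 | (θ : ℝ) ≤ lam z.1 ω}.indicator 1 z.2.1 * ‖b z.2.2‖ₑ) ∂P ω) ∂Q := by
          refine lintegral_mono_ae ?_
          filter_upwards [hH.ofReal_intensity_le hψ] with ω hω
          calc _ ≤ G n (t, ω) * (_ + L * _) := mul_le_mul_right (hω t ht) _
            _ ≤ _ := by
              rw [mul_add]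
              refine add_le_add (mul_le_of_le_one_left bot_le (hG1 n _)) ?_
              rw [mul_left_comm]
              gcongr
              have hGfin : G n (t, ω) ≠ ∞ := ne_top_of_le_ne_top ENNReal.one_ne_top (hG1 n _)
              rw [← lintegral_const_mul' _ _ hGfin]
              refine lintegral_mono fun z => ?_
              by_cases h1 : z.1 < t
              · rw [← mul_assoc]
                refine mul_le_mul_left ?_ _
                rw [mul_comm]
                exact mul_le_mul_right (hGanti n ω _ _ h1.le) _
              · simp [indicator, h1]
      _ = ENNReal.ofReal (ψ 0) + L * ((∫⁻ y, ‖b y‖ₑ ∂ν) * ∫⁻ s, ∫⁻ ω, W (s, ω) *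
            lebesgueNN {θ : ℝ≥0 | (θ : ℝ) ≤ lam s ω} ∂Q ∂lebesgueNN) := by
          rw [lintegral_add_left' aemeasurable_const, lintegral_const, measure_univ, mul_one,
            lintegral_const_mul'' _ hae, heq]
      _ = _ := by
          congr 1
          rw [← mul_assoc, ← lintegral_indicator measurableSet_Iio, ← lintegral_const_mul _ ?_]
          · refine lintegral_congr fun s => ?_
            simp only [lebesgueNN_le]
            by_cases h1 : s < t
            · simp only [W, indicator_of_mem (mem_Iio.2 h1), u]
              simp only [mul_assoc]
              rw [lintegral_const_mul' _ _ enorm_ne_top]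
            · simp [W, indicator, h1]
          · simp only [lebesgueNN_le]
            exact ((hW.mono (predictable_le ℱ) le_rfl).mul hlam).lintegral_prod_right'
  have hbound : ∀ n, u n t ≤ B := fun n =>
    le_of_le_add_convolution (hh.enorm.const_mul _) (hum n) hρ hρ1 hB (hufin n) (hrec n) t ht
  -- The bound `B` is uniform in `n`; paths being integrable, the cutoff is eventually 1 and
  -- monotone convergence removes it.
  have hsup : ∀ᵐ ω ∂Q, ENNReal.ofReal (lam t ω) =
      ⨆ n, G n (t, ω) * ENNReal.ofReal (lam t ω) := by
    filter_upwards [hH.integrable_path] with ω hω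
    refine le_antisymm ?_ (iSup_le fun n => mul_le_of_le_one_left bot_le (hG1 n _))
    have hfin : C (t, ω) < ∞ := by
      refine lt_of_le_of_lt ?_ hω.2
      refine (lintegral_mono_set fun r (hr : r < t) =>
        (⟨bot_le, hr.le.trans ht⟩ : r ∈ Icc 0 T)).trans (lintegral_mono fun r => ?_)
      rw [Real.enorm_eq_ofReal_abs]
      exact ENNReal.ofReal_le_ofReal (le_abs_self _)
    obtain ⟨n, hn⟩ := ENNReal.exists_nat_gt hfin.ne
    refine le_iSup_of_le n ?_
    simp [G, hn.le]
  rw [lintegral_congr_ae hsup, lintegral_iSup']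
  · exact iSup_le hbound
  · exact fun n => (((hGm n).mul hlam).comp
      (by fun_prop : Measurable fun ω => (t, ω))).aemeasurable
  · refine ae_of_all _ fun ω i j hij => mul_le_mul_left ?_ _
    refine indicator_le_indicator_of_subset (fun p (hp : C p ≤ i) => ?_) (fun _ => bot_le) _
    exact hp.trans (Nat.cast_le.2 hij)

end Intensity

/-! ### Weighted thinned integrands and their expected distances. -/

section Accepted

/-- The integrand `w(s) 1_{θ ≤ ℓ(s)} c(y)`. -/
noncomputable def accepted (w ℓ : ℝ≥0 → ℝ) (c : ℝ → ℝ) (z : Pt) : ℝ :=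
  w z.1 * ({θ : ℝ≥0 | (θ : ℝ) ≤ ℓ z.1}.indicator 1 z.2.1 * c z.2.2)

variable {w w' ℓ ℓ' : ℝ≥0 → ℝ} {c : ℝ → ℝ}

theorem enorm_accepted (w ℓ : ℝ≥0 → ℝ) (c : ℝ → ℝ) (z : Pt) :
    ‖accepted w ℓ c z‖ₑ =
      ‖w z.1‖ₑ * ({θ : ℝ≥0 | (θ : ℝ) ≤ ℓ z.1}.indicator 1 z.2.1 * ‖c z.2.2‖ₑ) := by
  rw [accepted, enorm_mul, enorm_mul]
  by_cases h : (z.2.1 : ℝ) ≤ ℓ z.1 <;> simp [h]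

/-- Inserting w 1_{θ ≤ ℓ'} separates the errors. The choice is asymmetric: the first weight
multiplies the distance of the levels, the second level multiplies the distance of the weights. It
decides which mean intensity appears in later bounds. -/
theorem enorm_accepted_sub_le (w w' ℓ ℓ' : ℝ≥0 → ℝ) (c : ℝ → ℝ) (z : Pt) :
    ‖accepted w ℓ c z - accepted w' ℓ' c z‖ₑ ≤
      ‖w z.1‖ₑ * ((between (ℓ z.1) (ℓ' z.1)).indicator 1 z.2.1 * ‖c z.2.2‖ₑ) +
      ‖w z.1 - w' z.1‖ₑ * ({θ : ℝ≥0 | (θ : ℝ) ≤ ℓ' z.1}.indicator 1 z.2.1 * ‖c z.2.2‖ₑ) := by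
  by_cases h : (z.2.1 : ℝ) ≤ ℓ z.1 <;> by_cases h' : (z.2.1 : ℝ) ≤ ℓ' z.1 <;>
    simp [accepted, between, h, h', ← enorm_mul, sub_mul]
  simpa using enorm_sub_le (a := w z.1 * c z.2.2) (b := w z.1 * c z.2.2 - w' z.1 * c z.2.2)

theorem measurable_accepted (hw : Measurable w) (hℓ : Measurable ℓ) (hc : Measurable c) :
    Measurable (accepted w ℓ c) := by
  have h1 : MeasurableSet {z : Pt | (z.2.1 : ℝ) ≤ ℓ z.1} :=
    measurableSet_le (by fun_prop) (hℓ.comp measurable_fst)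
  have h2 : Measurable ({z : Pt | (z.2.1 : ℝ) ≤ ℓ z.1}.indicator (1 : Pt → ℝ)) :=
    measurable_one.indicator h1
  exact (hw.comp measurable_fst).mul (h2.mul (hc.comp (by fun_prop)))

variable {ν : Measure ℝ} [IsProbabilityMeasure ν] {Ω : Type*} [MeasurableSpace Ω] {Q : Measure Ω}
  [IsProbabilityMeasure Q] {P : Ω → Measure Pt}

theorem IsPoissonMeasure.lintegral_accepted (hP : IsPoissonMeasure P (intensityMeasure ν) Q)
    {α : ℝ≥0 → Ω → ℝ}
    (hα : Measurable[(poissonFiltration P hP.measurable).predictable] (Function.uncurry α))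
    (hw : Measurable w) (hc : Measurable c) :
    AEMeasurable (fun ω => ∫⁻ z, ‖accepted w (α · ω) c z‖ₑ ∂P ω) Q ∧
      ∫⁻ ω, ∫⁻ z, ‖accepted w (α · ω) c z‖ₑ ∂P ω ∂Q =
        (∫⁻ y, ‖c y‖ₑ ∂ν) * ∫⁻ s, ‖w s‖ₑ * ∫⁻ ω, ENNReal.ofReal (α s ω) ∂Q ∂lebesgueNN := by
  set ℱ := poissonFiltration P hP.measurable
  have hW : Measurable[ℱ.predictable] fun p : ℝ≥0 × Ω => ‖w p.1‖ₑ :=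
    hw.enorm.comp measurable_predictable_fst
  obtain ⟨h1, h2⟩ := hP.lintegral_thinning hW
    (D := fun p => {θ : ℝ≥0 | (θ : ℝ) ≤ α p.1 p.2})
    (@measurableSet_le_snd _ ℱ.predictable _ hα) hc.enorm
  simp only [enorm_accepted]
  refine ⟨h1, h2.trans ?_⟩
  simp only [lebesgueNN_le, lintegral_const_mul' _ _ enorm_ne_top]

theorem IsPoissonMeasure.ae_integrable_accepted
    (hP : IsPoissonMeasure P (intensityMeasure ν) Q) {α : ℝ≥0 → Ω → ℝ}
    (hα : Measurable[(poissonFiltration P hP.measurable).predictable] (Function.uncurry α))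
    (hw : Measurable w) (hc : Measurable c) (hcν : Integrable c ν)
    (hfin : ∫⁻ s, ‖w s‖ₑ * ∫⁻ ω, ENNReal.ofReal (α s ω) ∂Q ∂lebesgueNN ≠ ∞) :
    ∀ᵐ ω ∂Q, Integrable (accepted w (α · ω) c) (P ω) := by
  obtain ⟨h1, h2⟩ := hP.lintegral_accepted hα hw hc
  have h3 : ∫⁻ y, ‖c y‖ₑ ∂ν ≠ ∞ := hcν.2.ne
  filter_upwards [ae_lt_top' h1 (by rw [h2]; finiteness)] with ω hω
  have hαω : Measurable fun s => α s ω :=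
    (hα.mono (predictable_le _) le_rfl).comp (by fun_prop : Measurable fun s => (s, ω))
  exact ⟨(measurable_accepted hw hαω hc).aestronglyMeasurable, hω⟩

theorem IsPoissonMeasure.lintegral_accepted_sub_le
    (hP : IsPoissonMeasure P (intensityMeasure ν) Q) {α β : ℝ≥0 → Ω → ℝ}
    (hα : Measurable[(poissonFiltration P hP.measurable).predictable] (Function.uncurry α))
    (hβ : Measurable[(poissonFiltration P hP.measurable).predictable] (Function.uncurry β))
    (hw : Measurable w) (hw' : Measurable w') (hc : Measurable c) :
    ∫⁻ ω, ∫⁻ z, ‖accepted w (α · ω) c z - accepted w' (β · ω) c z‖ₑ ∂P ω ∂Q ≤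
      (∫⁻ y, ‖c y‖ₑ ∂ν) * (∫⁻ s, ‖w s‖ₑ * ∫⁻ ω, ‖α s ω - β s ω‖ₑ ∂Q ∂lebesgueNN +
        ∫⁻ s, ‖w s - w' s‖ₑ * ∫⁻ ω, ENNReal.ofReal (β s ω) ∂Q ∂lebesgueNN) := by
  set ℱ := poissonFiltration P hP.measurable
  have hW : Measurable[ℱ.predictable] fun p : ℝ≥0 × Ω => ‖w p.1‖ₑ :=
    hw.enorm.comp measurable_predictable_fst
  obtain ⟨h1, h2⟩ := hP.lintegral_thinning hW
    (D := fun p => between (α p.1 p.2) (β p.1 p.2))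
    (@measurableSet_between _ ℱ.predictable _ _ hα hβ) hc.enorm
  obtain ⟨h3, h4⟩ := hP.lintegral_accepted (w := w - w') hβ (hw.sub hw') hc
  simp only [enorm_accepted, Pi.sub_apply] at h3 h4
  calc _ ≤ ∫⁻ ω, (∫⁻ z, ‖w z.1‖ₑ * ((between (α z.1 ω) (β z.1 ω)).indicator 1 z.2.1 *
            ‖c z.2.2‖ₑ) ∂P ω +
          ∫⁻ z, ‖w z.1 - w' z.1‖ₑ * ({θ : ℝ≥0 | (θ : ℝ) ≤ β z.1 ω}.indicator 1 z.2.1 *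
            ‖c z.2.2‖ₑ) ∂P ω) ∂Q := by
        refine lintegral_mono fun ω => ?_
        have hβω : Measurable fun s => β s ω :=
          (hβ.mono (predictable_le _) le_rfl).comp (by fun_prop : Measurable fun s => (s, ω))
        rw [← lintegral_add_right]
        · exact lintegral_mono fun z => enorm_accepted_sub_le w w' (α · ω) (β · ω) c z
        · have := (measurable_accepted (hw.sub hw') hβω hc).enorm
          simpa only [enorm_accepted, Pi.sub_apply] using this
    _ ≤ _ := by
        rw [lintegral_add_left' h1, h2, h4, mul_add]
        gcongr with s
        rw [← lintegral_const_mul' _ _ enorm_ne_top]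
        gcongr with ω
        exact lebesgueNN_between_le _ _

theorem setIntegral_under_eq (m : Measure Pt) {A : Set ℝ≥0} (hA : MeasurableSet A)
    (w ℓ : ℝ≥0 → ℝ) (c : ℝ → ℝ) :
    ∫ z in A ×ˢ univ, (under ℓ).indicator (fun z : Pt => w z.1 * c z.2.2) z ∂m =
      ∫ z, accepted (A.indicator w) ℓ c z ∂m := by
  rw [← integral_indicator (hA.prod MeasurableSet.univ)]
  refine integral_congr_ae (ae_of_all _ fun z => ?_)
  by_cases h1 : z.1 ∈ A <;> by_cases h2 : (z.2.1 : ℝ) ≤ ℓ z.1 <;>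
    simp [accepted, under, indicator, h1, h2]

theorem binIntegral_eq (m : Measure Pt) (Δ : ℝ≥0) (f : ℝ → ℝ) (k : ℕ) (a : ℝ) :
    binIntegral m Δ f k a = ∫ z, accepted
      ((Ioc (((k - 1 : ℕ) : ℝ≥0) * Δ) ((k : ℝ≥0) * Δ)).indicator 1) (fun _ => a) f z ∂m := by
  rw [binIntegral, ← setIntegral_under_eq m measurableSet_Ioc]
  simp

end Accepted

/-! ### Bins of the time grid: the ceiling of s/Δ is the index of the bin of s. -/

section Grid

variable {Δ : ℝ≥0}

theorem ceil_div_eq_iff (hΔ : 0 < Δ) (n : ℕ) (s : ℝ≥0) :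
    ⌈(s : ℝ) / (Δ : ℝ)⌉₊ = n + 1 ↔ s ∈ Ioc ((n : ℝ≥0) * Δ) ((n + 1 : ℝ≥0) * Δ) := by
  have hΔ' : (0 : ℝ) < Δ := hΔ
  simp only [mem_Ioc, ← NNReal.coe_lt_coe, ← NNReal.coe_le_coe, NNReal.coe_mul,
    NNReal.coe_add, NNReal.coe_natCast, NNReal.coe_one]
  rw [Nat.ceil_eq_iff (by simp), lt_div_iff₀ hΔ', div_le_iff₀ hΔ']
  simp

theorem ceil_div_mem_iff (hΔ : 0 < Δ) (i j : ℕ) (s : ℝ≥0) :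
    ⌈(s : ℝ) / (Δ : ℝ)⌉₊ ∈ Finset.Ico (i + 1) (j + 1) ↔
      s ∈ Ioc ((i : ℝ≥0) * Δ) ((j : ℝ≥0) * Δ) := by
  have hΔ' : (0 : ℝ) < Δ := hΔ
  simp only [mem_Ioc, ← NNReal.coe_lt_coe, ← NNReal.coe_le_coe, NNReal.coe_mul,
    NNReal.coe_natCast, Finset.mem_Ico, Nat.succ_le_iff, Nat.lt_succ_iff]
  rw [Nat.lt_ceil, Nat.ceil_le, lt_div_iff₀ hΔ', div_le_iff₀ hΔ']

theorem sum_bin_indicator (hΔ : 0 < Δ) (i j : ℕ) (a : ℕ → ℝ) (s : ℝ≥0) :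
    ∑ k ∈ Finset.Ico (i + 1) (j + 1),
      a k * (Ioc (((k - 1 : ℕ) : ℝ≥0) * Δ) ((k : ℝ≥0) * Δ)).indicator (1 : ℝ≥0 → ℝ) s =
    (Ioc ((i : ℝ≥0) * Δ) ((j : ℝ≥0) * Δ)).indicator (fun s => a ⌈(s : ℝ) / (Δ : ℝ)⌉₊) s := by
  classical
  have h1 : ∀ k ∈ Finset.Ico (i + 1) (j + 1),
      a k * (Ioc (((k - 1 : ℕ) : ℝ≥0) * Δ) ((k : ℝ≥0) * Δ)).indicator (1 : ℝ≥0 → ℝ) s =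
        if ⌈(s : ℝ) / (Δ : ℝ)⌉₊ = k then a k else 0 := fun k hk => by
    obtain ⟨n, rfl⟩ : ∃ n, k = n + 1 := ⟨k - 1, by have := (Finset.mem_Ico.1 hk).1; omega⟩
    rw [Nat.add_sub_cancel, Nat.cast_add, Nat.cast_one, if_congr (ceil_div_eq_iff hΔ n s) rfl rfl]
    by_cases h : s ∈ Ioc ((n : ℝ≥0) * Δ) ((n + 1 : ℝ≥0) * Δ)
    · rw [indicator_of_mem h, if_pos h]; simp
    · rw [indicator_of_notMem h, if_neg h, mul_zero]
  rw [Finset.sum_congr rfl h1, Finset.sum_ite_eq]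
  by_cases h : s ∈ Ioc ((i : ℝ≥0) * Δ) ((j : ℝ≥0) * Δ)
  · rw [if_pos ((ceil_div_mem_iff hΔ i j s).2 h), indicator_of_mem h]
  · rw [if_neg (fun h' => h ((ceil_div_mem_iff hΔ i j s).1 h')), indicator_of_notMem h]

/-- A weighted sum of bin integrals as a single integral. -/
theorem sum_binIntegral_eq (hΔ : 0 < Δ) (m : Measure Pt) (i j : ℕ) (a l : ℕ → ℝ) (f : ℝ → ℝ)
    (hint : ∀ k ∈ Finset.Ico (i + 1) (j + 1), Integrable (accepted
      ((Ioc (((k - 1 : ℕ) : ℝ≥0) * Δ) ((k : ℝ≥0) * Δ)).indicator 1)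
      (fun s => l ⌈(s : ℝ) / (Δ : ℝ)⌉₊) f) m) :
    ∑ k ∈ Finset.Ico (i + 1) (j + 1), a k * binIntegral m Δ f k (l k) =
      ∫ z, accepted ((Ioc ((i : ℝ≥0) * Δ) ((j : ℝ≥0) * Δ)).indicator
        fun s => a ⌈(s : ℝ) / (Δ : ℝ)⌉₊) (fun s => l ⌈(s : ℝ) / (Δ : ℝ)⌉₊) f z ∂m := by
  have h1 : ∀ k ∈ Finset.Ico (i + 1) (j + 1), binIntegral m Δ f k (l k) =
      ∫ z, accepted ((Ioc (((k - 1 : ℕ) : ℝ≥0) * Δ) ((k : ℝ≥0) * Δ)).indicator 1)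
        (fun s => l ⌈(s : ℝ) / (Δ : ℝ)⌉₊) f z ∂m := fun k hk => by
    rw [binIntegral_eq]
    refine integral_congr_ae (ae_of_all _ fun z => ?_)
    obtain ⟨n, rfl⟩ : ∃ n, k = n + 1 := ⟨k - 1, by have := (Finset.mem_Ico.1 hk).1; omega⟩
    simp only [accepted, Nat.add_sub_cancel, Nat.cast_add, Nat.cast_one]
    by_cases h : z.1 ∈ Ioc ((n : ℝ≥0) * Δ) ((n + 1 : ℝ≥0) * Δ)
    · rw [(ceil_div_eq_iff hΔ n z.1).2 h]
    · rw [indicator_of_notMem h, zero_mul, zero_mul]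
  rw [Finset.sum_congr rfl fun k hk => by rw [h1 k hk, ← integral_const_mul],
    ← integral_finsetSum _ fun k hk => (hint k hk).const_mul (a k)]
  refine integral_congr_ae (ae_of_all _ fun z => ?_)
  simp only [accepted, ← mul_assoc, ← Finset.sum_mul]
  rw [sum_bin_indicator hΔ i j a z.1]

end Grid

/-! ### Measurability of the discrete intensity. -/

section DiscreteMeasurability

variable {Δ : ℝ≥0} {h ψ b : ℝ → ℝ}

theorem discreteIntensity_eq_sum_binIntegral (m : Measure Pt) (Δ : ℝ≥0) (h ψ b : ℝ → ℝ) (n : ℕ) :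
    discreteIntensity m Δ h ψ b n = ψ (∑ k ∈ Finset.Ico 1 n, h (((n : ℝ) - (k : ℝ)) * (Δ : ℝ)) *
      binIntegral m Δ b k (discreteIntensity m Δ h ψ b k)) := by
  rw [discreteIntensity_eq]
  congr 1
  refine Finset.sum_congr rfl fun k hk => ?_
  have hk0 : k ≠ 0 := by have := (Finset.mem_Ico.mp hk).1; omega
  rw [discreteMark, if_neg hk0]

theorem measurable_binIntegral {Ω : Type*} [MeasurableSpace Ω] (κ : Kernel Ω Pt)
    [IsSFiniteKernel κ] {f : ℝ → ℝ} (hf : Measurable f) (k : ℕ) {l : Ω → ℝ} (hl : Measurable l) :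
    Measurable fun ω => binIntegral (κ ω) Δ f k (l ω) := by
  simp only [binIntegral_eq]
  have hF : Measurable fun p : Ω × Pt => accepted
      ((Ioc (((k - 1 : ℕ) : ℝ≥0) * Δ) ((k : ℝ≥0) * Δ)).indicator 1) (fun _ => l p.1) f p.2 := by
    have h1 : MeasurableSet {p : Ω × Pt | (p.2.2.1 : ℝ) ≤ l p.1} :=
      measurableSet_le (by fun_prop) (hl.comp measurable_fst)
    have h2 : Measurable ({p : Ω × Pt | (p.2.2.1 : ℝ) ≤ l p.1}.indicator (1 : Ω × Pt → ℝ)) :=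
      measurable_one.indicator h1
    have h3 : Measurable ((Ioc (((k - 1 : ℕ) : ℝ≥0) * Δ) ((k : ℝ≥0) * Δ)).indicator
        (1 : ℝ≥0 → ℝ)) := measurable_one.indicator measurableSet_Ioc
    exact (h3.comp (by fun_prop : Measurable fun p : Ω × Pt => p.2.1)).mul
      (h2.mul (hf.comp (by fun_prop)))
  exact hF.stronglyMeasurable.integral_kernel_prod_right'.measurable

theorem measurable_discreteIntensity {Ω : Type*} [MeasurableSpace Ω] (κ : Kernel Ω Pt)
    [IsSFiniteKernel κ] (hψ : Measurable ψ) (hb : Measurable b) (n : ℕ) :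
    Measurable fun ω => discreteIntensity (κ ω) Δ h ψ b n := by
  induction n using Nat.strong_induction_on with
  | _ n ih =>
    simp only [discreteIntensity_eq_sum_binIntegral (κ _) Δ h ψ b n]
    refine hψ.comp (Finset.measurable_sum _ fun k hk => ?_)
    exact (measurable_binIntegral κ hb k (ih k (Finset.mem_Ico.1 hk).2)).const_mul _

/-- The recursion for l_n reads only the bins 1, …, n - 1; this is what makes the sequence
predictable on the grid. -/
theorem discreteIntensity_restrict (m : Measure Pt) (Δ : ℝ≥0) (h ψ b : ℝ → ℝ) (N n : ℕ)
    (hn : n - 1 ≤ N) :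
    discreteIntensity (m.restrict (Ioc 0 ((N : ℝ≥0) * Δ) ×ˢ univ)) Δ h ψ b n =
      discreteIntensity m Δ h ψ b n := by
  induction n using Nat.strong_induction_on with
  | _ n ih =>
    rw [discreteIntensity_eq_sum_binIntegral, discreteIntensity_eq_sum_binIntegral m]
    congr 1
    refine Finset.sum_congr rfl fun k hk => ?_
    have hk := Finset.mem_Ico.1 hk
    rw [ih k hk.2 (by omega), binIntegral, binIntegral,
      Measure.restrict_restrict (measurableSet_Ioc.prod MeasurableSet.univ), inter_eq_left.2]
    refine prod_mono (Ioc_subset_Ioc bot_le ?_) subset_rfl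
    have : (k : ℝ≥0) ≤ N := Nat.cast_le.2 (by omega)
    gcongr

variable {ν : Measure ℝ} [IsProbabilityMeasure ν] {Ω : Type*} [MeasurableSpace Ω] {Q : Measure Ω}
  {P : Ω → Measure Pt}

/-- Away from a null set, the discrete intensity is a predictable sequence on the grid. -/
theorem IsPoissonMeasure.exists_adapted_discreteIntensity
    (hP : IsPoissonMeasure P (intensityMeasure ν) Q) (Δ : ℝ≥0) (h : ℝ → ℝ) (hψ : Measurable ψ)
    (hb : Measurable b) :
    ∃ d : ℕ → Ω → ℝ,
      (∀ n, Measurable[poissonFiltration P hP.measurable (((n - 1 : ℕ) : ℝ≥0) * Δ)] (d n)) ∧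
      ∀ᵐ ω ∂Q, ∀ n, d n ω = discreteIntensity (P ω) Δ h ψ b n := by
  set ℱ := poissonFiltration P hP.measurable
  -- The filtration is not completed, so the exceptional null set cannot simply be discarded. For
  -- each t the past of `P` is replaced by a kernel measurable with respect to `ℱ t`, equal to it
  -- almost surely.
  have hker : ∀ t : ℝ≥0, ∃ κ : @Kernel Ω Pt (ℱ t) _, @IsSFiniteKernel _ _ (ℱ t) _ κ ∧
      ∀ ω, (∀ n, P ω (Ioc 0 t ×ˢ univ ∩ window n) < ∞) → κ ω =
        (P ω).restrict (Ioc 0 t ×ˢ univ) := fun t => by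
    refine @exists_kernel_eq_restrict _ _ (ℱ t) _ P _ (measurableSet_Ioc.prod MeasurableSet.univ)
      window measurableSet_window iUnion_window fun A hA hAt => ?_
    rw [measurable_iff_comap_le]
    exact le_iSup₂_of_le (f := fun (A : Set Pt)
      (_ : A ∈ {A : Set Pt | MeasurableSet A ∧ A ⊆ Ioc 0 t ×ˢ univ}) =>
        MeasurableSpace.comap (fun ω => P ω A) inferInstance) A ⟨hA, hAt⟩ le_rfl
  choose κ hκs hκ using hker
  refine ⟨fun n ω => discreteIntensity (κ (((n - 1 : ℕ) : ℝ≥0) * Δ) ω) Δ h ψ b n, fun n => ?_, ?_⟩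
  · have := hκs (((n - 1 : ℕ) : ℝ≥0) * Δ)
    exact @measurable_discreteIntensity _ _ _ _ _ (ℱ (((n - 1 : ℕ) : ℝ≥0) * Δ))
      (κ (((n - 1 : ℕ) : ℝ≥0) * Δ)) _ hψ hb n
  · filter_upwards [hP.ae_window_lt_top] with ω hω n
    rw [hκ _ ω fun N => (measure_mono inter_subset_right).trans_lt (hω N),
      discreteIntensity_restrict _ _ _ _ _ _ _ le_rfl]

end DiscreteMeasurability

/-! ### The mean of the discrete intensity. -/

section DiscreteMean

variable {L : ℝ≥0} {Δ : ℝ≥0} {h ψ b : ℝ → ℝ} {ν : Measure ℝ} [IsProbabilityMeasure ν]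
  {Ω : Type*} [MeasurableSpace Ω] {Q : Measure Ω} [IsProbabilityMeasure Q] {P : Ω → Measure Pt}

theorem enorm_binIntegral_le (hΔ : 0 < Δ) (m : Measure Pt) (f : ℝ → ℝ) {k : ℕ} (hk : 1 ≤ k)
    (l : ℕ → ℝ) :
    ‖binIntegral m Δ f k (l k)‖ₑ ≤ ∫⁻ z, ‖accepted
      ((Ioc (((k - 1 : ℕ) : ℝ≥0) * Δ) ((k : ℝ≥0) * Δ)).indicator 1)
        (fun s => l ⌈(s : ℝ) / (Δ : ℝ)⌉₊) f z‖ₑ ∂m := by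
  rw [binIntegral_eq]
  refine (enorm_integral_le_lintegral_enorm _).trans (lintegral_mono fun z => le_of_eq ?_)
  obtain ⟨n, rfl⟩ : ∃ n, k = n + 1 := ⟨k - 1, by omega⟩
  simp only [accepted, Nat.add_sub_cancel, Nat.cast_add, Nat.cast_one]
  by_cases h : z.1 ∈ Ioc ((n : ℝ≥0) * Δ) ((n + 1 : ℝ≥0) * Δ)
  · rw [(ceil_div_eq_iff hΔ n z.1).2 h]
  · rw [indicator_of_notMem h, zero_mul, zero_mul]

theorem measurable_indicator_Ioc (a b : ℝ≥0) : Measurable ((Ioc a b).indicator (1 : ℝ≥0 → ℝ)) :=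
  measurable_one.indicator measurableSet_Ioc

theorem lintegral_bin_mul (hΔ : 0 < Δ) {k : ℕ} (hk : 1 ≤ k) (x : ℕ → ℝ≥0∞) :
    ∫⁻ s, ‖(Ioc (((k - 1 : ℕ) : ℝ≥0) * Δ) ((k : ℝ≥0) * Δ)).indicator (1 : ℝ≥0 → ℝ) s‖ₑ *
      x ⌈(s : ℝ) / (Δ : ℝ)⌉₊ ∂lebesgueNN = Δ * x k := by
  obtain ⟨n, rfl⟩ : ∃ n, k = n + 1 := ⟨k - 1, by omega⟩
  simp only [Nat.add_sub_cancel, Nat.cast_add, Nat.cast_one]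
  calc _ = ∫⁻ s, (Ioc ((n : ℝ≥0) * Δ) ((n + 1 : ℝ≥0) * Δ)).indicator (fun _ => x (n + 1)) s
          ∂lebesgueNN := by
        refine lintegral_congr fun s => ?_
        by_cases h : s ∈ Ioc ((n : ℝ≥0) * Δ) ((n + 1 : ℝ≥0) * Δ)
        · rw [(ceil_div_eq_iff hΔ n s).2 h, indicator_of_mem h, indicator_of_mem h]
          simp
        · rw [indicator_of_notMem h, indicator_of_notMem h]
          simp
    _ = _ := by
        rw [lintegral_indicator_const measurableSet_Ioc, lebesgueNN_Ioc, mul_comm]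
        congr 1
        push_cast
        rw [add_mul, one_mul, add_sub_cancel_left, ENNReal.ofReal_coe_nnreal]

theorem measurable_predictable_uncurry_step {ℱ : Filtration ℝ≥0 ‹MeasurableSpace Ω›}
    (hΔ : 0 < Δ) {d : ℕ → Ω → ℝ} (hd : ∀ n, Measurable[ℱ (((n - 1 : ℕ) : ℝ≥0) * Δ)] (d n)) :
    Measurable[ℱ.predictable]
      (Function.uncurry fun (s : ℝ≥0) ω => d ⌈(s : ℝ) / (Δ : ℝ)⌉₊ ω) :=
  measurable_predictable_step hΔ hd

/-- The expected discrete intensity is bounded by every `B` with `ψ(0) + ρ_{h,Δ} B ≤ B`. -/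
theorem IsPoissonMeasure.lintegral_discreteIntensity_le
    (hP : IsPoissonMeasure P (intensityMeasure ν) Q) (hψ : LipschitzWith L ψ) (hb : Measurable b)
    (hΔ : 0 < Δ) {d : ℕ → Ω → ℝ}
    (hd : ∀ n, Measurable[poissonFiltration P hP.measurable (((n - 1 : ℕ) : ℝ≥0) * Δ)] (d n))
    (hdP : ∀ᵐ ω ∂Q, ∀ n, d n ω = discreteIntensity (P ω) Δ h ψ b n) {M : ℕ} {ρ B : ℝ≥0∞}
    (hρ : ∑ k ∈ Finset.Icc 1 M, L * (∫⁻ y, ‖b y‖ₑ ∂ν) * (‖h (k * Δ)‖ₑ * Δ) ≤ ρ)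
    (hB : ENNReal.ofReal (ψ 0) + ρ * B ≤ B) {n : ℕ} (hn : n ≤ M) :
    ∫⁻ ω, ENNReal.ofReal (d n ω) ∂Q ≤ B := by
  induction n using Nat.strong_induction_on with
  | _ n ih =>
    let J : ℕ → Ω → ℝ≥0∞ := fun k ω => ∫⁻ z, ‖accepted
      ((Ioc (((k - 1 : ℕ) : ℝ≥0) * Δ) ((k : ℝ≥0) * Δ)).indicator 1)
        (fun s => d ⌈(s : ℝ) / (Δ : ℝ)⌉₊ ω) b z‖ₑ ∂P ω
    have hJ := fun k : ℕ => hP.lintegral_accepted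
      (w := (Ioc (((k - 1 : ℕ) : ℝ≥0) * Δ) ((k : ℝ≥0) * Δ)).indicator 1)
      (measurable_predictable_uncurry_step hΔ hd) (measurable_indicator_Ioc _ _) hb
    have hJk : ∀ k, 1 ≤ k → ∫⁻ ω, J k ω ∂Q =
        (∫⁻ y, ‖b y‖ₑ ∂ν) * (Δ * ∫⁻ ω, ENNReal.ofReal (d k ω) ∂Q) := fun k hk => by
      rw [(hJ k).2, lintegral_bin_mul hΔ hk fun k => ∫⁻ ω, ENNReal.ofReal (d k ω) ∂Q]
    calc ∫⁻ ω, ENNReal.ofReal (d n ω) ∂Q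
        ≤ ∫⁻ ω, (ENNReal.ofReal (ψ 0) + ∑ k ∈ Finset.Ico 1 n,
            L * (‖h (((n - k : ℕ) : ℝ) * Δ)‖ₑ * J k ω)) ∂Q := by
          refine lintegral_mono_ae ?_
          filter_upwards [hdP] with ω hω
          rw [hω n, discreteIntensity_eq_sum_binIntegral]
          refine (ofReal_lipschitz_le hψ _).trans ?_
          rw [← Finset.mul_sum]
          gcongr
          refine (enorm_sum_le _ _).trans (Finset.sum_le_sum fun k hk => ?_)
          have hk := Finset.mem_Ico.1 hk
          rw [enorm_mul, Nat.cast_sub hk.2.le]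
          gcongr
          have := enorm_binIntegral_le hΔ (P ω) b hk.1 fun k => d k ω
          rwa [hω k] at this
      _ = ENNReal.ofReal (ψ 0) + ∑ k ∈ Finset.Ico 1 n, L * (‖h (((n - k : ℕ) : ℝ) * Δ)‖ₑ *
            ((∫⁻ y, ‖b y‖ₑ ∂ν) * (Δ * ∫⁻ ω, ENNReal.ofReal (d k ω) ∂Q))) := by
          rw [lintegral_add_left' aemeasurable_const, lintegral_const, measure_univ, mul_one,
            lintegral_finsetSum' _ fun k _ => (((hJ k).1.const_mul _).const_mul _)]
          congr 1
          refine Finset.sum_congr rfl fun k hk => ?_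
          rw [lintegral_const_mul'' _ ((hJ k).1.const_mul _), lintegral_const_mul'' _ (hJ k).1,
            hJk k (Finset.mem_Ico.1 hk).1]
      _ ≤ ENNReal.ofReal (ψ 0) + ∑ k ∈ Finset.Ico 1 n, L * (∫⁻ y, ‖b y‖ₑ ∂ν) *
            (‖h (((n - k : ℕ) : ℝ) * Δ)‖ₑ * Δ) * B := by
          refine add_le_add le_rfl (Finset.sum_le_sum fun k hk => ?_)
          have hk := Finset.mem_Ico.1 hk
          have := ih k hk.2 (hk.2.le.trans hn)
          calc _ = L * (∫⁻ y, ‖b y‖ₑ ∂ν) * (‖h (((n - k : ℕ) : ℝ) * Δ)‖ₑ * Δ) *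
                ∫⁻ ω, ENNReal.ofReal (d k ω) ∂Q := by ring
            _ ≤ _ := by gcongr
      _ ≤ ENNReal.ofReal (ψ 0) + ρ * B := by
          rw [← Finset.sum_mul]
          gcongr
          refine le_trans ?_ hρ
          -- Reversing the sum by k ↦ n - k lists the lags 1, …, n - 1, all among the lags 1, …, M
          -- of ρ_{h,Δ}.
          rw [Finset.sum_nbij' (t := Finset.Ico 1 n)
            (g := fun k : ℕ => L * (∫⁻ y, ‖b y‖ₑ ∂ν) * (‖h (k * Δ)‖ₑ * Δ))
            (fun k => n - k) (fun k => n - k)]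
          · refine Finset.sum_le_sum_of_subset fun k hk => ?_
            simp only [Finset.mem_Ico, Finset.mem_Icc] at hk ⊢
            omega
          · intro k hk; simp only [Finset.mem_Ico] at hk ⊢; omega
          · intro k hk; simp only [Finset.mem_Ico] at hk ⊢; omega
          · intro k hk; simp only [Finset.mem_Ico] at hk; omega
          · intro k hk; simp only [Finset.mem_Ico] at hk; omega
          · intro k _; rfl
      _ ≤ B := hB

end DiscreteMean

/-! ### The distance between the two intensities. -/

section IntensityDifference

variable {L : ℝ≥0} {T Δ : ℝ≥0} {M : ℕ} {h ψ b : ℝ → ℝ}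
  {Ω : Type*} [MeasurableSpace Ω] {Q : Measure Ω} {P : Ω → Measure Pt} {R lam : ℝ≥0 → Ω → ℝ}
  {d : ℕ → Ω → ℝ}

/-- The integral equation of the intensity, with an `accepted` integrand. -/
theorem IsHawkes.intensity_eq_accepted {hP : Measurable P}
    (hH : IsHawkes Q P hP T h ψ b R lam) : ∀ᵐ ω ∂Q, ∀ t ≤ T, lam t ω =
      ψ (∫ z, accepted ((Iio t).indicator fun s : ℝ≥0 => h (t - s)) (lam · ω) b z ∂P ω) := by
  filter_upwards [hH.intensity_eq] with ω hω t ht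
  have hIco : Ico 0 t = Iio t := by ext; simp
  rw [hω t ⟨bot_le, ht⟩, hIco, ← setIntegral_under_eq _ measurableSet_Iio]

theorem IsHawkes.enorm_intensity_eq {hP : Measurable P} (hψ0 : ∀ x, 0 ≤ ψ x)
    (hH : IsHawkes Q P hP T h ψ b R lam) :
    ∀ᵐ ω ∂Q, ∀ t ≤ T, ‖lam t ω‖ₑ = ENNReal.ofReal (lam t ω) := by
  filter_upwards [hH.intensity_eq] with ω hω t ht
  rw [hω t ⟨bot_le, ht⟩, Real.enorm_eq_ofReal (hψ0 _)]

variable {ν : Measure ℝ} [IsProbabilityMeasure ν] [IsProbabilityMeasure Q]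
  {hP : IsPoissonMeasure P (intensityMeasure ν) Q}

theorem IsPoissonMeasure.ae_integrable_bin (hP : IsPoissonMeasure P (intensityMeasure ν) Q)
    (hΔ : 0 < Δ)
    (hd : ∀ n, Measurable[poissonFiltration P hP.measurable (((n - 1 : ℕ) : ℝ≥0) * Δ)] (d n))
    {B : ℝ≥0∞} (hB : B ≠ ∞) (hdB : ∀ n ≤ M, ∫⁻ ω, ENNReal.ofReal (d n ω) ∂Q ≤ B)
    {c : ℝ → ℝ} (hc : Measurable c) (hcν : Integrable c ν) :
    ∀ᵐ ω ∂Q, ∀ k, 1 ≤ k → k ≤ M → Integrable (accepted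
      ((Ioc (((k - 1 : ℕ) : ℝ≥0) * Δ) ((k : ℝ≥0) * Δ)).indicator 1)
      (fun s => d ⌈(s : ℝ) / (Δ : ℝ)⌉₊ ω) c) (P ω) := by
  refine ae_all_iff.2 fun k => ?_
  by_cases hk : 1 ≤ k ∧ k ≤ M
  · have := hP.ae_integrable_accepted (measurable_predictable_uncurry_step hΔ hd)
      (measurable_indicator_Ioc (((k - 1 : ℕ) : ℝ≥0) * Δ) ((k : ℝ≥0) * Δ)) hc hcν (by
        rw [lintegral_bin_mul hΔ hk.1 fun k => ∫⁻ ω, ENNReal.ofReal (d k ω) ∂Q]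
        have := ne_top_of_le_ne_top hB (hdB k hk.2)
        finiteness)
    exact this.mono fun ω hω _ _ => hω
  · exact ae_of_all _ fun ω h1 h2 => absurd ⟨h1, h2⟩ hk

theorem ceil_div_le (hΔ : 0 < Δ) (hT : T = M * Δ) {t : ℝ≥0} (ht : t ≤ T) :
    ⌈(t : ℝ) / (Δ : ℝ)⌉₊ ≤ M := by
  have hΔ' : (0 : ℝ) < Δ := hΔ
  rw [Nat.ceil_le, div_le_iff₀ hΔ']
  exact_mod_cast hT ▸ ht

/-- The recursion for the expected distance between the two intensities. -/
theorem IsHawkes.lintegral_intensity_sub_le_add (hψ : LipschitzWith L ψ) (hb : Measurable b)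
    (hbν : Integrable b ν) (hh : Measurable h) (hhT : IntegrableOn h (Icc 0 (T : ℝ)))
    (hΔ : 0 < Δ) (hT : T = M * Δ) (hH : IsHawkes Q P hP.measurable T h ψ b R lam)
    (hd : ∀ n, Measurable[poissonFiltration P hP.measurable (((n - 1 : ℕ) : ℝ≥0) * Δ)] (d n))
    (hdP : ∀ᵐ ω ∂Q, ∀ n, d n ω = discreteIntensity (P ω) Δ h ψ b n) {B B' : ℝ≥0∞}
    (hB : B ≠ ∞) (hB' : B' ≠ ∞) (hlB : ∀ t ≤ T, ∫⁻ ω, ENNReal.ofReal (lam t ω) ∂Q ≤ B)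
    (hdB : ∀ n ≤ M, ∫⁻ ω, ENNReal.ofReal (d n ω) ∂Q ≤ B') {t : ℝ≥0} (ht : t ≤ T) :
    ∫⁻ ω, ‖lam t ω - d ⌈(t : ℝ) / (Δ : ℝ)⌉₊ ω‖ₑ ∂Q ≤
      L * (∫⁻ y, ‖b y‖ₑ ∂ν) * (ENNReal.ofReal (constR h T Δ) * B') +
      ∫⁻ s in Iio t, L * (∫⁻ y, ‖b y‖ₑ ∂ν) * ‖h (t - s)‖ₑ *
        ∫⁻ ω, ‖lam s ω - d ⌈(s : ℝ) / (Δ : ℝ)⌉₊ ω‖ₑ ∂Q ∂lebesgueNN := by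
  -- The index 0 occurs only at t = 0, where both pasts are empty and both intensities equal ψ(0).
  rcases Nat.eq_zero_or_pos ⌈(t : ℝ) / (Δ : ℝ)⌉₊ with h0 | hpos
  · have hΔ' : (0 : ℝ) < Δ := hΔ
    have ht0 : t = 0 := by
      rw [Nat.ceil_eq_zero, div_le_iff₀ hΔ', zero_mul] at h0
      exact le_antisymm (by exact_mod_cast h0) bot_le
    refine le_trans (le_of_eq ?_) bot_le
    refine (lintegral_congr_ae ?_).trans lintegral_zero
    filter_upwards [hH.intensity_eq, hdP] with ω h1 h2
    rw [h0, h1 t ⟨bot_le, ht⟩, h2, discreteIntensity_eq, ht0]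
    simp
  obtain ⟨m, hm⟩ : ∃ m, ⌈(t : ℝ) / (Δ : ℝ)⌉₊ = m + 1 := ⟨_, (Nat.succ_pred_eq_of_pos hpos).symm⟩
  have hmM : m + 1 ≤ M := hm ▸ ceil_div_le hΔ hT ht
  have htm := (ceil_div_eq_iff hΔ m t).1 hm
  have htm1 : (m : ℝ) * Δ < t := by exact_mod_cast htm.1
  have htm2 : (t : ℝ) ≤ (m + 1) * Δ := by exact_mod_cast htm.2
  have hmT : ((m : ℝ) + 1) * Δ ≤ T := by
    rw [hT]
    push_cast
    have : (m : ℝ) + 1 ≤ M := by exact_mod_cast hmM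
    gcongr
  -- For t in bin m + 1, `w` is the continuous kernel seen from t, and `w'` is the step kernel of
  -- l_{m+1}, supported in (0, mΔ].
  let a : ℕ → ℝ := fun k => h ((((m + 1 : ℕ) : ℝ) - (k : ℝ)) * (Δ : ℝ))
  let w : ℝ≥0 → ℝ := (Iio t).indicator fun s : ℝ≥0 => h (t - s)
  let w' : ℝ≥0 → ℝ := (Ioc (((0 : ℕ) : ℝ≥0) * Δ) ((m : ℝ≥0) * Δ)).indicator
    fun s => a ⌈(s : ℝ) / (Δ : ℝ)⌉₊
  have hw : Measurable w :=
    (hh.comp (by fun_prop : Measurable fun s : ℝ≥0 => (t : ℝ) - s)).indicator measurableSet_Iio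
  have hw' : Measurable w' := by
    refine Measurable.indicator ?_ measurableSet_Ioc
    exact (measurable_from_top (f := a)).comp
      (Nat.measurable_ceil.comp (by fun_prop : Measurable fun s : ℝ≥0 => (s : ℝ) / (Δ : ℝ)))
  have hww : Measurable fun s => ‖w s - w' s‖ₑ := (hw.sub hw').enorm
  have hw0 : ∀ s, ¬ s < t → w s = 0 := fun s hs => indicator_of_notMem (by simpa using hs) _
  have hw0' : ∀ s, ¬ s < t → w' s = 0 := fun s hs =>
    indicator_of_notMem (fun hs' => hs (lt_of_le_of_lt hs'.2 htm.1)) _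
  have hIw : ∫⁻ s, ‖w s‖ₑ ∂lebesgueNN ≠ ∞ := by
    have h1 : ∀ s, ‖w s‖ₑ = (Iio t).indicator (fun s : ℝ≥0 => ‖h (t - s)‖ₑ) s := fun s => by
      by_cases hs : s < t <;> simp [w, hs]
    simp only [h1]
    rw [lintegral_indicator measurableSet_Iio,
      setLIntegral_Iio_lebesgueNN fun s => ‖h (t - s)‖ₑ,
      setLIntegral_comp_sub_left fun x => ‖h x‖ₑ]
    refine ne_top_of_le_ne_top hhT.2.ne (lintegral_mono_set fun x hx => ?_)
    rw [sub_self, sub_zero] at hx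
    exact ⟨hx.1.le, hx.2.trans (by exact_mod_cast ht)⟩
  have hIww : ∫⁻ s, ‖w s - w' s‖ₑ ∂lebesgueNN ≤ ENNReal.ofReal (constR h T Δ) := by
    refine le_trans (le_of_eq ?_)
      (lintegral_sub_discretised_kernel_le hh hhT (NNReal.coe_pos.2 hΔ) htm1 htm2 hmT)
    rw [← setLIntegral_Iio_lebesgueNN (fun s => ‖h (t - s) - (Ioc 0 (m * (Δ : ℝ))).indicator
      (fun s => h (((m + 1 : ℝ) - ⌈s / Δ⌉₊) * Δ)) s‖ₑ), ← lintegral_indicator measurableSet_Iio]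
    refine lintegral_congr fun s => ?_
    by_cases hs : s < t
    · rw [indicator_of_mem (mem_Iio.2 hs)]
      have h2 : w' s = (Ioc 0 (m * (Δ : ℝ))).indicator
          (fun s => h (((m + 1 : ℝ) - ⌈s / Δ⌉₊) * Δ)) (s : ℝ) := by
        have hiff : s ∈ Ioc (((0 : ℕ) : ℝ≥0) * Δ) ((m : ℝ≥0) * Δ) ↔
            (s : ℝ) ∈ Ioc 0 (m * (Δ : ℝ)) := by
          simp only [mem_Ioc, ← NNReal.coe_lt_coe, ← NNReal.coe_le_coe, NNReal.coe_mul,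
            NNReal.coe_natCast, Nat.cast_zero, zero_mul, NNReal.coe_zero]
        by_cases hs' : s ∈ Ioc (((0 : ℕ) : ℝ≥0) * Δ) ((m : ℝ≥0) * Δ)
        · rw [indicator_of_mem (hiff.1 hs')]
          simp only [w', indicator_of_mem hs', a]
          push_cast
          rfl
        · rw [indicator_of_notMem fun h' => hs' (hiff.2 h')]
          simp only [w', indicator_of_notMem hs']
      rw [h2]
      simp only [w, indicator_of_mem (mem_Iio.2 hs)]
    · rw [indicator_of_notMem (by simpa using hs), hw0 s hs, hw0' s hs]
      simp
  -- Finite L¹ norm of the step kernel, from that of `w` and the discretisation error.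
  have hIw' : ∫⁻ s, ‖w' s‖ₑ ∂lebesgueNN ≠ ∞ := by
    have : ∫⁻ s, ‖w' s‖ₑ ∂lebesgueNN ≤
        ∫⁻ s, ‖w s‖ₑ ∂lebesgueNN + ∫⁻ s, ‖w s - w' s‖ₑ ∂lebesgueNN := by
      rw [← lintegral_add_left hw.enorm]
      refine lintegral_mono fun s => ?_
      simpa using enorm_sub_le (a := w s) (b := w s - w' s)
    exact ne_top_of_le_ne_top (ENNReal.add_ne_top.2
      ⟨hIw, ne_top_of_le_ne_top ENNReal.ofReal_ne_top hIww⟩) this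
  have hdt : ∀ s < t, ∫⁻ ω, ENNReal.ofReal (d ⌈(s : ℝ) / (Δ : ℝ)⌉₊ ω) ∂Q ≤ B' := fun s hs =>
    hdB _ (ceil_div_le hΔ hT (hs.le.trans ht))
  have hstep := measurable_predictable_uncurry_step (ℱ := poissonFiltration P hP.measurable) hΔ hd
  -- The mean bounds make both integrands almost surely integrable against `P`, so the Bochner
  -- integrals may be subtracted.
  have hint := hP.ae_integrable_accepted hH.measurable_predictable hw hb hbν (by
    refine ne_top_of_le_ne_top (ENNReal.mul_ne_top hIw hB) ?_
    rw [← lintegral_mul_const _ hw.enorm]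
    refine lintegral_mono fun s => ?_
    by_cases hs : s < t
    · exact mul_le_mul_right (hlB s (hs.le.trans ht)) _
    · simp [hw0 s hs])
  have hint' := hP.ae_integrable_accepted hstep hw' hb hbν (by
    refine ne_top_of_le_ne_top (ENNReal.mul_ne_top hIw' hB') ?_
    rw [← lintegral_mul_const _ hw'.enorm]
    refine lintegral_mono fun s => ?_
    by_cases hs : s < t
    · exact mul_le_mul_right (hdt s hs) _
    · simp [hw0' s hs])
  calc ∫⁻ ω, ‖lam t ω - d ⌈(t : ℝ) / (Δ : ℝ)⌉₊ ω‖ₑ ∂Q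
      ≤ ∫⁻ ω, L * ∫⁻ z, ‖accepted w (lam · ω) b z -
          accepted w' (fun s => d ⌈(s : ℝ) / (Δ : ℝ)⌉₊ ω) b z‖ₑ ∂P ω ∂Q := by
        refine lintegral_mono_ae ?_
        filter_upwards [hH.intensity_eq_accepted, hdP, hint, hint',
          hP.ae_integrable_bin hΔ hd hB' hdB hb hbν] with ω h1 h2 h3 h4 h5
        have e1 : d ⌈(t : ℝ) / (Δ : ℝ)⌉₊ ω = ψ (∫ z, accepted w'
            (fun s => d ⌈(s : ℝ) / (Δ : ℝ)⌉₊ ω) b z ∂P ω) := by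
          rw [← sum_binIntegral_eq hΔ (P ω) 0 m a (fun k => d k ω) b, hm, h2,
            discreteIntensity_eq_sum_binIntegral]
          · simp only [h2, zero_add, a]
          · intro k hk
            have := Finset.mem_Ico.1 hk
            exact h5 k (by omega) (by omega)
        rw [h1 t ht, e1, ← edist_eq_enorm_sub]
        refine (hψ _ _).trans ?_
        gcongr
        rw [edist_eq_enorm_sub, ← integral_sub h3 h4]
        exact enorm_integral_le_lintegral_enorm _
    _ = L * ∫⁻ ω, ∫⁻ z, ‖accepted w (lam · ω) b z -
          accepted w' (fun s => d ⌈(s : ℝ) / (Δ : ℝ)⌉₊ ω) b z‖ₑ ∂P ω ∂Q :=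
        lintegral_const_mul' _ _ ENNReal.coe_ne_top
    -- The continuous kernel carries the distance of intensities, so the recursion contracts with
    -- ρ_h; the kernel error is weighted by the discrete mean `B'`.
    _ ≤ L * ((∫⁻ y, ‖b y‖ₑ ∂ν) *
          (∫⁻ s, ‖w s‖ₑ * ∫⁻ ω, ‖lam s ω - d ⌈(s : ℝ) / (Δ : ℝ)⌉₊ ω‖ₑ ∂Q ∂lebesgueNN +
            ENNReal.ofReal (constR h T Δ) * B')) := by
        refine mul_le_mul_right ((hP.lintegral_accepted_sub_le hH.measurable_predictable hstep
          hw hw' hb).trans (mul_le_mul_right (add_le_add le_rfl ?_) _)) _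
        refine le_trans ?_ (mul_le_mul_left hIww _)
        rw [← lintegral_mul_const _ hww]
        refine lintegral_mono fun s => ?_
        by_cases hs : s < t
        · exact mul_le_mul_right (hdt s hs) _
        · simp [hw0 s hs, hw0' s hs]
    _ = _ := by
        rw [mul_add, mul_add, ← mul_assoc, ← mul_assoc, add_comm]
        congr 1
        have hEb : L * (∫⁻ y, ‖b y‖ₑ ∂ν) ≠ ∞ := ENNReal.mul_ne_top ENNReal.coe_ne_top hbν.2.ne
        rw [← lintegral_const_mul' _ _ hEb, ← lintegral_indicator measurableSet_Iio]
        refine lintegral_congr fun s => ?_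
        by_cases hs : s < t <;> simp [w, hs, mul_assoc]

/-- The expected distance between the two intensities is bounded by every `D` with
`L E[b] C_R B' + ρ_h D ≤ D`, where `B'` bounds the expected discrete intensity. -/
theorem IsHawkes.lintegral_intensity_sub_le (hψ0 : ∀ x, 0 ≤ ψ x) (hψ : LipschitzWith L ψ)
    (hb : Measurable b)
    (hbν : Integrable b ν) (hh : Measurable h) (hhT : IntegrableOn h (Icc 0 (T : ℝ)))
    (hΔ : 0 < Δ) (hT : T = M * Δ) (hH : IsHawkes Q P hP.measurable T h ψ b R lam)
    (hd : ∀ n, Measurable[poissonFiltration P hP.measurable (((n - 1 : ℕ) : ℝ≥0) * Δ)] (d n))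
    (hdP : ∀ᵐ ω ∂Q, ∀ n, d n ω = discreteIntensity (P ω) Δ h ψ b n) {B B' D ρ : ℝ≥0∞}
    (hB : B ≠ ∞) (hB' : B' ≠ ∞) (hlB : ∀ t ≤ T, ∫⁻ ω, ENNReal.ofReal (lam t ω) ∂Q ≤ B)
    (hdB : ∀ n ≤ M, ∫⁻ ω, ENNReal.ofReal (d n ω) ∂Q ≤ B')
    (hρ : ∫⁻ x in Ioc 0 (T : ℝ), L * (∫⁻ y, ‖b y‖ₑ ∂ν) * ‖h x‖ₑ ≤ ρ) (hρ1 : ρ < 1)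
    (hD : L * (∫⁻ y, ‖b y‖ₑ ∂ν) * (ENNReal.ofReal (constR h T Δ) * B') + ρ * D ≤ D)
    {t : ℝ≥0} (ht : t ≤ T) :
    ∫⁻ ω, ‖lam t ω - d ⌈(t : ℝ) / (Δ : ℝ)⌉₊ ω‖ₑ ∂Q ≤ D := by
  have hstep := (measurable_predictable_uncurry_step
    (ℱ := poissonFiltration P hP.measurable) hΔ hd).mono (predictable_le _) le_rfl
  have hlam := hH.measurable_intensity
  refine le_of_le_add_convolution (hh.enorm.const_mul _)
    (hlam.sub hstep).enorm.lintegral_prod_right' hρ hρ1 hD ?_ (fun t ht =>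
      hH.lintegral_intensity_sub_le_add (hP := hP) hψ hb hbν hh hhT hΔ hT hd hdP hB hB'
        hlB hdB ht) t ht
  -- The integrability required by the Volterra inequality: the distance is at most the sum of the
  -- two means, on an interval of length T.
  refine ne_top_of_le_ne_top (b := (B + B') * T) (by finiteness) ?_
  calc _ ≤ ∫⁻ s in Iic T, (B + B') ∂lebesgueNN := by
        refine setLIntegral_mono' measurableSet_Iic fun s hs => ?_
        calc _ ≤ ∫⁻ ω, (ENNReal.ofReal (lam s ω) +
                ENNReal.ofReal (d ⌈(s : ℝ) / (Δ : ℝ)⌉₊ ω)) ∂Q := by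
              refine lintegral_mono_ae ?_
              filter_upwards [hH.enorm_intensity_eq hψ0, hdP] with ω h1 h2
              refine enorm_sub_le.trans ?_
              simp only [Function.uncurry_apply_pair]
              rw [h1 s hs, h2, discreteIntensity_eq, Real.enorm_eq_ofReal (hψ0 _)]
          _ ≤ B + B' := by
              rw [lintegral_add_left]
              · exact add_le_add (hlB s hs) (hdB _ (ceil_div_le hΔ hT hs))
              · exact ENNReal.measurable_ofReal.comp
                  (hlam.comp (by fun_prop : Measurable fun ω => (s, ω)))
    _ = _ := by rw [setLIntegral_const, lebesgueNN_Iic]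

end IntensityDifference

/-! ### From intensities to increments of the risks. -/

section RiskDifference

variable {L : ℝ≥0} {T Δ : ℝ≥0} {M : ℕ} {h ψ b : ℝ → ℝ} {ν : Measure ℝ} [IsProbabilityMeasure ν]
  {Ω : Type*} [MeasurableSpace Ω] {Q : Measure Ω} {P : Ω → Measure Pt}

theorem IsPoissonMeasure.aemeasurable_discreteRisk
    (hP : IsPoissonMeasure P (intensityMeasure ν) Q) (hψ : Measurable ψ) (hb : Measurable b)
    (t : ℝ≥0) : AEMeasurable (fun ω => discreteRisk (P ω) Δ h ψ b t) Q := by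
  obtain ⟨κ, hκs, hκ⟩ := exists_kernel_eq_restrict (P := P) MeasurableSet.univ
    measurableSet_window iUnion_window
    (fun A hA _ => (Measure.measurable_coe hA).comp hP.measurable)
  refine ⟨fun ω => discreteRisk (κ ω) Δ h ψ b t, ?_, ?_⟩
  · exact Finset.measurable_sum _ fun k _ => measurable_binIntegral κ measurable_id k
      (measurable_discreteIntensity κ hψ hb k)
  · filter_upwards [hP.ae_window_lt_top] with ω hω
    rw [hκ ω fun n => by simpa using hω n, Measure.restrict_univ]

variable {R lam : ℝ≥0 → Ω → ℝ}

theorem IsHawkes.risk_eq_accepted {hP : Measurable P} (hH : IsHawkes Q P hP T h ψ b R lam) :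
    ∀ᵐ ω ∂Q, ∀ t ≤ T, R t ω =
      ∫ z, accepted ((Ioc 0 t).indicator 1) (lam · ω) (fun y => y) z ∂P ω := by
  filter_upwards [hH.risk_eq] with ω hω t ht
  rw [hω t ⟨bot_le, ht⟩, ← setIntegral_under_eq _ measurableSet_Ioc]
  simp

theorem discreteRisk_sub (m : Measure Pt) {s t : ℝ≥0} (hst : s ≤ t) :
    discreteRisk m Δ h ψ b t - discreteRisk m Δ h ψ b s =
      ∑ k ∈ Finset.Ico (⌊s / Δ⌋₊ + 1) (⌊t / Δ⌋₊ + 1), (1 : ℝ) *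
        binIntegral m Δ (fun y => y) k (discreteIntensity m Δ h ψ b k) := by
  have hle : ⌊s / Δ⌋₊ ≤ ⌊t / Δ⌋₊ := Nat.floor_le_floor (by gcongr)
  have hIcc : ∀ n : ℕ, Finset.Icc 1 n = Finset.Ico 1 (n + 1) := fun n => by
    ext k; simp
  simp only [one_mul]
  rw [discreteRisk, discreteRisk, hIcc, hIcc, Finset.sum_Ico_eq_sub _ (by omega : _ ≤ _),
    Finset.sum_Ico_eq_sub _ (by omega : 1 ≤ ⌊s / Δ⌋₊ + 1), Finset.sum_Ico_eq_sub _
    (by omega : ⌊s / Δ⌋₊ + 1 ≤ ⌊t / Δ⌋₊ + 1)]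
  ring

theorem accepted_Ioc_sub {s t : ℝ≥0} (hst : s ≤ t) (ℓ : ℝ≥0 → ℝ) (c : ℝ → ℝ) (z : Pt) :
    accepted ((Ioc 0 t).indicator 1) ℓ c z - accepted ((Ioc 0 s).indicator 1) ℓ c z =
      accepted ((Ioc s t).indicator 1) ℓ c z := by
  have h1 : (Ioc 0 t).indicator (1 : ℝ≥0 → ℝ) z.1 - (Ioc 0 s).indicator 1 z.1 =
      (Ioc s t).indicator 1 z.1 := by
    rw [← Ioc_union_Ioc_eq_Ioc (zero_le : (0 : ℝ≥0) ≤ s) hst,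
      indicator_union_of_disjoint (Ioc_disjoint_Ioc_of_le le_rfl)]
    exact add_sub_cancel_left _ _
  simp only [accepted, ← h1, sub_mul]

/-- Two windows whose end points differ by at most `Δ` to the left. -/
theorem enorm_indicator_Ioc_sub_le {s t s' t' : ℝ≥0} (hs : s' ≤ s) (ht : t' ≤ t) (x : ℝ≥0) :
    ‖(Ioc s' t').indicator (1 : ℝ≥0 → ℝ) x - (Ioc s t).indicator 1 x‖ₑ ≤
      (Ioc s' s).indicator 1 x + (Ioc t' t).indicator 1 x := by
  by_cases h' : x ∈ Ioc s' t' <;> by_cases h : x ∈ Ioc s t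
  · simp [indicator_of_mem h, indicator_of_mem h']
  · have hx : x ∈ Ioc s' s := ⟨h'.1, not_lt.1 fun hsx => h ⟨hsx, h'.2.trans ht⟩⟩
    rw [indicator_of_notMem h, indicator_of_mem h', indicator_of_mem hx]
    simp
  · have hx : x ∈ Ioc t' t :=
      ⟨not_le.1 fun hxt => h' ⟨lt_of_le_of_lt hs h.1, hxt⟩, h.2⟩
    rw [indicator_of_mem h, indicator_of_notMem h', indicator_of_mem hx]
    simp
  · simp [indicator_of_notMem h, indicator_of_notMem h']

theorem lintegral_indicator_one_mul_le {a c : ℝ≥0} {δ : ℝ≥0} (hac : c ≤ a + δ) {u : ℝ≥0 → ℝ≥0∞}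
    {B : ℝ≥0∞} (hu : ∀ x ≤ c, u x ≤ B) :
    ∫⁻ x, (Ioc a c).indicator 1 x * u x ∂lebesgueNN ≤ δ * B := by
  calc _ ≤ ∫⁻ x, (Ioc a c).indicator (fun _ => B) x ∂lebesgueNN := by
        refine lintegral_mono fun x => ?_
        by_cases hx : x ∈ Ioc a c
        · simpa [indicator_of_mem hx] using hu x hx.2
        · simp [indicator_of_notMem hx]
    _ = ENNReal.ofReal (c - a) * B := by
        rw [lintegral_indicator_const measurableSet_Ioc, lebesgueNN_Ioc, mul_comm]
    _ ≤ δ * B := by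
        gcongr
        rw [← ENNReal.ofReal_coe_nnreal]
        refine ENNReal.ofReal_le_ofReal ?_
        have : (c : ℝ) ≤ a + δ := by exact_mod_cast hac
        linarith

variable [IsProbabilityMeasure Q] {hP : IsPoissonMeasure P (intensityMeasure ν) Q}
  {d : ℕ → Ω → ℝ}

/-- The expected distance between the increments of the two risks, given bounds for the
intensities and for their distance. -/
theorem IsHawkes.lintegral_risk_sub_le (hν : Integrable (fun y : ℝ => y) ν)
    (hΔ : 0 < Δ) (hT : T = M * Δ) (hH : IsHawkes Q P hP.measurable T h ψ b R lam)
    (hd : ∀ n, Measurable[poissonFiltration P hP.measurable (((n - 1 : ℕ) : ℝ≥0) * Δ)] (d n))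
    (hdP : ∀ᵐ ω ∂Q, ∀ n, d n ω = discreteIntensity (P ω) Δ h ψ b n) {B B' D : ℝ≥0∞}
    (hB : B ≠ ∞) (hB' : B' ≠ ∞) (hlB : ∀ t ≤ T, ∫⁻ ω, ENNReal.ofReal (lam t ω) ∂Q ≤ B)
    (hdB : ∀ n ≤ M, ∫⁻ ω, ENNReal.ofReal (d n ω) ∂Q ≤ B')
    (hD : ∀ t ≤ T, ∫⁻ ω, ‖lam t ω - d ⌈(t : ℝ) / (Δ : ℝ)⌉₊ ω‖ₑ ∂Q ≤ D)
    {s t : ℝ≥0} (hst : s ≤ t) (ht : t ≤ T) :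
    ∫⁻ ω, ‖(R t ω - R s ω) -
        (discreteRisk (P ω) Δ h ψ b t - discreteRisk (P ω) Δ h ψ b s)‖ₑ ∂Q ≤
      (∫⁻ y, ‖y‖ₑ ∂ν) * ((((⌊t / Δ⌋₊ - ⌊s / Δ⌋₊ : ℕ) : ℝ≥0) * Δ : ℝ≥0) * D +
        (Δ * B + Δ * B)) := by
  have hgrid : ∀ x : ℝ≥0, (⌊x / Δ⌋₊ : ℝ≥0) * Δ ≤ x ∧ x ≤ (⌊x / Δ⌋₊ : ℝ≥0) * Δ + Δ := fun x => by
    refine ⟨(le_div_iff₀ hΔ).1 (Nat.floor_le bot_le), ?_⟩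
    have := (div_le_iff₀ hΔ).1 (Nat.lt_floor_add_one (x / Δ)).le
    rwa [add_mul, one_mul] at this
  set i := ⌊s / Δ⌋₊
  set j := ⌊t / Δ⌋₊
  have hij : i ≤ j := Nat.floor_le_floor (by gcongr)
  have hjM : j ≤ M := by
    have h1 : (j : ℝ≥0) * Δ ≤ M * Δ := (hgrid t).1.trans (hT ▸ ht)
    exact_mod_cast (mul_le_mul_iff_left₀ hΔ).1 h1
  -- `w` is the window of the discrete increment, with end points on the grid; `w'` is that of the
  -- continuous one.
  let w : ℝ≥0 → ℝ := (Ioc ((i : ℝ≥0) * Δ) ((j : ℝ≥0) * Δ)).indicator 1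
  let w' : ℝ≥0 → ℝ := (Ioc s t).indicator 1
  have hw : Measurable w := measurable_indicator_Ioc _ _
  have hw' : Measurable w' := measurable_indicator_Ioc _ _
  have hstep := measurable_predictable_uncurry_step (ℱ := poissonFiltration P hP.measurable) hΔ hd
  have hlint : ∀ x ≤ T, ∀ᵐ ω ∂Q,
      Integrable (accepted ((Ioc 0 x).indicator 1) (lam · ω) fun y => y) (P ω) := fun x hx => by
    refine hP.ae_integrable_accepted hH.measurable_predictable (measurable_indicator_Ioc _ _)
      measurable_id hν (ne_top_of_le_ne_top (b := x * B) (by finiteness) ?_)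
    refine le_trans (lintegral_mono fun r => ?_) (lintegral_indicator_one_mul_le (a := 0)
      (by rw [zero_add]) fun r hr => hlB r (hr.trans hx))
    gcongr
    by_cases hr : r ∈ Ioc 0 x <;> simp [indicator, hr]
  calc _ ≤ ∫⁻ ω, ∫⁻ z, ‖accepted w (fun r => d ⌈(r : ℝ) / (Δ : ℝ)⌉₊ ω) (fun y => y) z -
          accepted w' (lam · ω) (fun y => y) z‖ₑ ∂P ω ∂Q := by
        refine lintegral_mono_ae ?_
        filter_upwards [hH.risk_eq_accepted, hdP, hlint t ht, hlint s (hst.trans ht),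
          hP.ae_integrable_bin hΔ hd hB' hdB measurable_id hν] with ω h1 h2 h3 h4 h5
        have h5' : ∀ k ∈ Finset.Ico (i + 1) (j + 1), _ := fun k hk =>
          h5 k (by have := Finset.mem_Ico.1 hk; omega) (by have := Finset.mem_Ico.1 hk; omega)
        have e1 : R t ω - R s ω = ∫ z, accepted w' (lam · ω) (fun y => y) z ∂P ω := by
          rw [h1 t ht, h1 s (hst.trans ht), ← integral_sub h3 h4]
          simp only [accepted_Ioc_sub hst, w']
        have e2 : discreteRisk (P ω) Δ h ψ b t - discreteRisk (P ω) Δ h ψ b s =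
            ∫ z, accepted w (fun r => d ⌈(r : ℝ) / (Δ : ℝ)⌉₊ ω) (fun y => y) z ∂P ω := by
          have := sum_binIntegral_eq hΔ (P ω) i j (fun _ => 1) (fun k => d k ω) (fun y => y) h5'
          simp only [h2] at this ⊢
          rw [discreteRisk_sub _ hst, this]
          rfl
        have i1 : Integrable (accepted w' (lam · ω) fun y => y) (P ω) :=
          (h3.sub h4).congr (ae_of_all _ fun z => accepted_Ioc_sub hst _ _ z)
        have i2 : Integrable (accepted w (fun r => d ⌈(r : ℝ) / (Δ : ℝ)⌉₊ ω) fun y => y)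
            (P ω) := by
          refine (integrable_finsetSum _ h5').congr (ae_of_all _ fun z => ?_)
          have := sum_bin_indicator hΔ i j (fun _ => (1 : ℝ)) z.1
          simp only [one_mul] at this
          simp only [accepted, ← Finset.sum_mul, this]
          rfl
        rw [e1, e2, enorm_sub_rev, ← integral_sub i2 i1]
        exact enorm_integral_le_lintegral_enorm _
    -- The discrete process is taken first. Thus the distance of intensities is integrated over the
    -- grid window, and the mismatch of windows is charged with the continuous mean, whose bound is
    -- free of ρ_{h,Δ}.
    _ ≤ (∫⁻ y, ‖y‖ₑ ∂ν) *
          (∫⁻ r, ‖w r‖ₑ * ∫⁻ ω, ‖d ⌈(r : ℝ) / (Δ : ℝ)⌉₊ ω - lam r ω‖ₑ ∂Q ∂lebesgueNN +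
            ∫⁻ r, ‖w r - w' r‖ₑ * ∫⁻ ω, ENNReal.ofReal (lam r ω) ∂Q ∂lebesgueNN) :=
        hP.lintegral_accepted_sub_le hstep hH.measurable_predictable hw hw' measurable_id
    _ ≤ _ := by
        refine mul_le_mul_right (add_le_add ?_ ?_) _
        · refine le_trans (lintegral_mono fun r => ?_)
            (lintegral_indicator_one_mul_le (a := i * Δ) (c := j * Δ)
            (u := fun r => ∫⁻ ω, ‖lam r ω - d ⌈(r : ℝ) / (Δ : ℝ)⌉₊ ω‖ₑ ∂Q) ?_
              fun r hr => hD r (hr.trans ((hgrid t).1.trans ht)))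
          · simp only [enorm_sub_rev (lam r _)]
            gcongr
            by_cases hr : r ∈ Ioc ((i : ℝ≥0) * Δ) ((j : ℝ≥0) * Δ) <;> simp [w, indicator, hr]
          · rw [← add_mul, ← Nat.cast_add, Nat.add_sub_cancel' hij]
        · have hm : Measurable fun r => ∫⁻ ω, ENNReal.ofReal (lam r ω) ∂Q :=
            (ENNReal.measurable_ofReal.comp hH.measurable_intensity).lintegral_prod_right'
          have hind : ∀ a c : ℝ≥0, Measurable ((Ioc a c).indicator (1 : ℝ≥0 → ℝ≥0∞)) :=
            fun a c => measurable_one.indicator measurableSet_Ioc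
          calc _ ≤ ∫⁻ r, ((Ioc ((i : ℝ≥0) * Δ) s).indicator 1 r *
                  ∫⁻ ω, ENNReal.ofReal (lam r ω) ∂Q +
                (Ioc ((j : ℝ≥0) * Δ) t).indicator 1 r *
                  ∫⁻ ω, ENNReal.ofReal (lam r ω) ∂Q) ∂lebesgueNN := by
                refine lintegral_mono fun r => ?_
                rw [← add_mul]
                exact mul_le_mul_left (enorm_indicator_Ioc_sub_le (hgrid s).1 (hgrid t).1 r) _
            _ ≤ _ := by
                rw [lintegral_add_left ((hind _ _).fun_mul hm)]
                exact add_le_add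
                  (lintegral_indicator_one_mul_le (hgrid s).2 fun r hr =>
                    hlB r (hr.trans (hst.trans ht)))
                  (lintegral_indicator_one_mul_le (hgrid t).2 fun r hr => hlB r (hr.trans ht))

end RiskDifference

/-! ### Translation of the constants between real and extended nonnegative numbers. -/

section Constants

variable {L : ℝ≥0} {ν : Measure ℝ} {b h : ℝ → ℝ}

/-- The number a/(1-ρ) is the fixed point of x ↦ a + ρx, the smallest bound admissible in the
Volterra and induction estimates. -/
theorem ofReal_add_mul_div_one_sub_le {a ρ : ℝ} (ha : 0 ≤ a) (hρ : 0 ≤ ρ) (hρ1 : ρ < 1) :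
    ENNReal.ofReal a + ENNReal.ofReal ρ * ENNReal.ofReal (a / (1 - ρ)) ≤
      ENNReal.ofReal (a / (1 - ρ)) := by
  have h1 : 0 < 1 - ρ := sub_pos.2 hρ1
  rw [← ENNReal.ofReal_mul hρ, ← ENNReal.ofReal_add ha (by positivity)]
  refine ENNReal.ofReal_le_ofReal (le_of_eq ?_)
  field_simp
  ring

theorem lintegral_enorm_eq_ofReal_of_nonneg (hb0 : ∀ y, 0 ≤ b y) (hb : Integrable b ν) :
    ∫⁻ y, ‖b y‖ₑ ∂ν = ENNReal.ofReal (∫ y, b y ∂ν) := by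
  rw [← ofReal_integral_norm_eq_lintegral_enorm hb]
  simp only [Real.norm_of_nonneg (hb0 _)]

theorem rho_nonneg (hb0 : ∀ y, 0 ≤ b y) {T : ℝ} (hT : 0 ≤ T) : 0 ≤ rho L ν b h T :=
  mul_nonneg (mul_nonneg L.coe_nonneg (intervalIntegral.integral_nonneg hT fun _ _ => abs_nonneg _))
    (integral_nonneg hb0)

theorem rhoDiscrete_nonneg (hb0 : ∀ y, 0 ≤ b y) (M : ℕ) {Δ : ℝ} (hΔ : 0 ≤ Δ) :
    0 ≤ rhoDiscrete L ν b h M Δ :=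
  mul_nonneg (mul_nonneg L.coe_nonneg (Finset.sum_nonneg fun _ _ => mul_nonneg (abs_nonneg _) hΔ))
    (integral_nonneg hb0)

theorem lintegral_mul_enorm_eq_ofReal_rho (hb0 : ∀ y, 0 ≤ b y) (hb : Integrable b ν)
    (hh : Measurable h) {T : ℝ} (hT : 0 ≤ T) (hhT : IntegrableOn h (Icc 0 T)) :
    ∫⁻ x in Ioc 0 T, L * (∫⁻ y, ‖b y‖ₑ ∂ν) * ‖h x‖ₑ = ENNReal.ofReal (rho L ν b h T) := by
  have hI : 0 ≤ ∫ t in (0 : ℝ)..T, |h t| :=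
    intervalIntegral.integral_nonneg hT fun _ _ => abs_nonneg _
  rw [lintegral_const_mul _ hh.enorm,
    lintegral_enorm_eq_ofReal hT (hhT.mono_set Ioc_subset_Icc_self),
    lintegral_enorm_eq_ofReal_of_nonneg hb0 hb, rho,
    ENNReal.ofReal_mul (mul_nonneg L.coe_nonneg hI),
    ENNReal.ofReal_mul L.coe_nonneg, ENNReal.ofReal_coe_nnreal]
  ring

theorem sum_mul_enorm_eq_ofReal_rhoDiscrete (hb0 : ∀ y, 0 ≤ b y) (hb : Integrable b ν)
    (M : ℕ) (Δ : ℝ≥0) :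
    ∑ k ∈ Finset.Icc 1 M, L * (∫⁻ y, ‖b y‖ₑ ∂ν) * (‖h (k * Δ)‖ₑ * Δ) =
      ENNReal.ofReal (rhoDiscrete L ν b h M Δ) := by
  have h0 : ∀ k ∈ Finset.Icc 1 M, 0 ≤ |h ((k : ℝ) * Δ)| * (Δ : ℝ) := fun k _ =>
    mul_nonneg (abs_nonneg _) Δ.coe_nonneg
  rw [← Finset.mul_sum, lintegral_enorm_eq_ofReal_of_nonneg hb0 hb, rhoDiscrete,
    ENNReal.ofReal_mul (mul_nonneg L.coe_nonneg (Finset.sum_nonneg h0)),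
    ENNReal.ofReal_mul L.coe_nonneg,
    ENNReal.ofReal_coe_nnreal, ENNReal.ofReal_sum_of_nonneg h0]
  simp only [ENNReal.ofReal_mul (abs_nonneg _), ENNReal.ofReal_coe_nnreal,
    ← Real.enorm_eq_ofReal_abs]
  ring

theorem gridProj_sub_gridProj (Δ : ℝ≥0) {s t : ℝ≥0} (hst : s ≤ t) :
    gridProj Δ t - gridProj Δ s = ((⌊t / Δ⌋₊ - ⌊s / Δ⌋₊ : ℕ) : ℝ) * Δ := by
  have hfl : ∀ x : ℝ≥0, gridProj Δ x = (⌊x / Δ⌋₊ : ℝ) * Δ := fun x => by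
    rw [gridProj, ← natCast_floor_eq_intCast_floor (by positivity), ← NNReal.coe_div]
    exact congrArg (fun n : ℕ => (n : ℝ) * (Δ : ℝ)) (Nonneg.nat_floor_coe _)
  rw [hfl, hfl, Nat.cast_sub (Nat.floor_le_floor (by gcongr)), sub_mul]

end Constants

end HawkesRisk

/-! ### The main estimate, with its constant. -/

open HawkesRisk

theorem mainTheorem5 (L : ℝ≥0) (ν : Measure ℝ) [IsProbabilityMeasure ν]
    (hν : Integrable (fun y : ℝ => y) ν)
    (b : ℝ → ℝ) (hb_meas : Measurable b) (hb_nonneg : ∀ y, 0 ≤ b y) (hb_int : Integrable b ν)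
    (p r : ℝ) (hr : r < 1) :
    ∃ K : ℝ, 0 < K ∧
      ∀ (ψ : ℝ → ℝ), (∀ x, 0 ≤ ψ x) → LipschitzWith L ψ → ψ 0 ≤ p →
      ∀ (T : ℝ≥0) (M : ℕ) (Δ : ℝ≥0), 1 ≤ M → Δ = T / (M : ℝ≥0) → Δ < T →
      ∀ (h : ℝ → ℝ), Measurable h → IntegrableOn h (Icc 0 (T : ℝ)) →
        HawkesRisk.rho L ν b h T ≤ r →
        HawkesRisk.rhoDiscrete L ν b h M Δ < 1 →
      ∀ (Ω : Type*) [MeasurableSpace Ω] (Q : Measure Ω) [IsProbabilityMeasure Q]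
        (P : Ω → Measure HawkesRisk.Pt)
        (hP : HawkesRisk.IsPoissonMeasure P (HawkesRisk.intensityMeasure ν) Q)
        (R lam : ℝ≥0 → Ω → ℝ),
        HawkesRisk.IsHawkes Q P hP.measurable T h ψ b R lam →
      ∀ s t : ℝ≥0, s ≤ t → t ≤ T →
        Integrable (fun ω => (R t ω - R s ω)
          - (HawkesRisk.discreteRisk (P ω) Δ h ψ b t
            - HawkesRisk.discreteRisk (P ω) Δ h ψ b s)) Q ∧
        ∫ ω, |(R t ω - R s ω)
          - (HawkesRisk.discreteRisk (P ω) Δ h ψ b t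
            - HawkesRisk.discreteRisk (P ω) Δ h ψ b s)| ∂Q
          ≤ K * (HawkesRisk.constS L ν b h T M Δ * HawkesRisk.constR h T Δ
              * (HawkesRisk.gridProj Δ t - HawkesRisk.gridProj Δ s) + Δ) := by
  have hr' : 0 < 1 - r := sub_pos.2 hr
  have hEb : 0 ≤ ∫ y, b y ∂ν := integral_nonneg hb_nonneg
  have hEY : 0 ≤ ∫ y, |y| ∂ν := integral_nonneg fun _ => abs_nonneg _
  -- The first summand is the coefficient of C_S C_R [(t)_Δ - (s)_Δ], the second that of Δ; the 1
  -- ensures positivity. The absolute value is needed because `K` is chosen before ψ, whose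
  -- existence forces p ≥ 0.
  refine ⟨(∫ y, |y| ∂ν) * (L * (∫ y, b y ∂ν) * |p| / (1 - r)) +
    (∫ y, |y| ∂ν) * (2 * (|p| / (1 - r))) + 1, by positivity, ?_⟩
  intro ψ hψ0 hψ hψp T M Δ hM hΔM hΔT h hh hhT hρ hρΔ Ω _ Q _ P hP R lam hH s t hst ht
  have hp : 0 ≤ p := (hψ0 0).trans hψp
  have hM0 : (0 : ℝ≥0) < M := by exact_mod_cast hM
  have hΔ : 0 < Δ := by rw [hΔM]; exact div_pos (lt_of_le_of_lt bot_le hΔT) hM0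
  have hT : T = M * Δ := by rw [hΔM, mul_div_cancel₀ _ hM0.ne']
  have hρ0 : 0 ≤ rho L ν b h T := rho_nonneg hb_nonneg T.coe_nonneg
  have hr0 : 0 ≤ r := hρ0.trans hρ
  have hρΔ0 : 0 ≤ rhoDiscrete L ν b h M Δ := rhoDiscrete_nonneg hb_nonneg M Δ.coe_nonneg
  have hρΔ' : 0 < 1 - rhoDiscrete L ν b h M Δ := sub_pos.2 hρΔ
  have hCR : 0 ≤ constR h T Δ := constR_nonneg Δ.coe_nonneg (by exact_mod_cast hΔT.le)
  have hψ_meas : Measurable ψ := hψ.continuous.measurable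
  obtain ⟨d, hd, hdP⟩ := hP.exists_adapted_discreteIntensity Δ h hψ_meas hb_meas
  have hρe : ∫⁻ x in Ioc 0 (T : ℝ), L * (∫⁻ y, ‖b y‖ₑ ∂ν) * ‖h x‖ₑ ≤ ENNReal.ofReal r := by
    rw [lintegral_mul_enorm_eq_ofReal_rho hb_nonneg hb_int hh T.coe_nonneg hhT]
    exact ENNReal.ofReal_le_ofReal hρ
  have hr1 : ENNReal.ofReal r < 1 := ENNReal.ofReal_lt_one.2 hr
  have hlB : ∀ u ≤ T, ∫⁻ ω, ENNReal.ofReal (lam u ω) ∂Q ≤ ENNReal.ofReal (p / (1 - r)) :=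
    fun u hu => hH.lintegral_intensity_le (hP := hP) hψ hb_meas hh hρe hr1
      ((add_le_add (ENNReal.ofReal_le_ofReal hψp) le_rfl).trans
        (ofReal_add_mul_div_one_sub_le hp hr0 hr)) hu
  have hdB : ∀ n ≤ M, ∫⁻ ω, ENNReal.ofReal (d n ω) ∂Q ≤
      ENNReal.ofReal (p / (1 - rhoDiscrete L ν b h M Δ)) :=
    fun n hn => hP.lintegral_discreteIntensity_le hψ hb_meas hΔ hd hdP
      (sum_mul_enorm_eq_ofReal_rhoDiscrete hb_nonneg hb_int M Δ).le
      ((add_le_add (ENNReal.ofReal_le_ofReal hψp) le_rfl).trans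
        (ofReal_add_mul_div_one_sub_le hp hρΔ0 hρΔ)) hn
  set q : ℝ := p / (1 - rhoDiscrete L ν b h M Δ) with hq
  have hq0 : 0 ≤ q := div_nonneg hp hρΔ'.le
  set a : ℝ := L * (∫ y, b y ∂ν) * (constR h T Δ * q) with ha
  have ha0 : 0 ≤ a := by positivity
  have hae : (L : ℝ≥0∞) * (∫⁻ y, ‖b y‖ₑ ∂ν) *
      (ENNReal.ofReal (constR h T Δ) * ENNReal.ofReal q) = ENNReal.ofReal a := by
    rw [ha, ENNReal.ofReal_mul (by positivity), ENNReal.ofReal_mul L.coe_nonneg,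
      ENNReal.ofReal_mul hCR,
      ENNReal.ofReal_coe_nnreal, lintegral_enorm_eq_ofReal_of_nonneg hb_nonneg hb_int]
  have hD : ∀ u ≤ T, ∫⁻ ω, ‖lam u ω - d ⌈(u : ℝ) / (Δ : ℝ)⌉₊ ω‖ₑ ∂Q ≤
      ENNReal.ofReal (a / (1 - r)) := fun u hu =>
    hH.lintegral_intensity_sub_le (hP := hP) hψ0 hψ hb_meas hb_int hh hhT hΔ hT hd hdP
      ENNReal.ofReal_ne_top ENNReal.ofReal_ne_top hlB hdB hρe hr1
      (hae ▸ ofReal_add_mul_div_one_sub_le ha0 hr0 hr) hu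
  have key := hH.lintegral_risk_sub_le (hP := hP) hν hΔ hT hd hdP ENNReal.ofReal_ne_top
    ENNReal.ofReal_ne_top hlB hdB hD hst ht
  set g : ℝ := gridProj Δ t - gridProj Δ s with hg
  have hgn : g = ((⌊t / Δ⌋₊ - ⌊s / Δ⌋₊ : ℕ) : ℝ) * Δ := gridProj_sub_gridProj Δ hst
  have hg0 : 0 ≤ g := by rw [hgn]; positivity
  have hbound : (∫⁻ y, ‖y‖ₑ ∂ν) * ((((⌊t / Δ⌋₊ - ⌊s / Δ⌋₊ : ℕ) : ℝ≥0) * Δ : ℝ≥0) *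
      ENNReal.ofReal (a / (1 - r)) +
        (Δ * ENNReal.ofReal (p / (1 - r)) + Δ * ENNReal.ofReal (p / (1 - r)))) =
      ENNReal.ofReal ((∫ y, |y| ∂ν) * (g * (a / (1 - r)) + 2 * (Δ * (p / (1 - r))))) := by
    have hY : ∫⁻ y, ‖y‖ₑ ∂ν = ENNReal.ofReal (∫ y, |y| ∂ν) :=
      (ofReal_integral_norm_eq_lintegral_enorm hν).symm
    rw [ENNReal.ofReal_mul hEY, ENNReal.ofReal_add (by positivity) (by positivity),
      ENNReal.ofReal_mul hg0, ENNReal.ofReal_mul (by norm_num), ENNReal.ofReal_mul Δ.coe_nonneg,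
      ENNReal.ofReal_coe_nnreal, hY, hgn, ← two_mul, ENNReal.ofReal_ofNat,
      ← ENNReal.ofReal_coe_nnreal (p := ((⌊t / Δ⌋₊ - ⌊s / Δ⌋₊ : ℕ) : ℝ≥0) * Δ)]
    simp
  rw [hbound] at key
  have hR : ∀ u, AEStronglyMeasurable (R u) Q := fun u =>
    ((hH.adapted u).mono ((poissonFiltration P hP.measurable).le u)).aestronglyMeasurable
  have hRd : ∀ u, AEStronglyMeasurable (fun ω => discreteRisk (P ω) Δ h ψ b u) Q := fun u =>
    (hP.aemeasurable_discreteRisk hψ_meas hb_meas u).aestronglyMeasurable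
  have hint : Integrable (fun ω => (R t ω - R s ω) -
      (discreteRisk (P ω) Δ h ψ b t - discreteRisk (P ω) Δ h ψ b s)) Q :=
    ⟨((hR t).sub (hR s)).sub ((hRd t).sub (hRd s)), key.trans_lt ENNReal.ofReal_lt_top⟩
  refine ⟨hint, ?_⟩
  rw [← ofReal_integral_norm_eq_lintegral_enorm hint, ENNReal.ofReal_le_ofReal_iff
    (by positivity)] at key
  refine key.trans ?_
  -- Only the discrete half of C_S is used; the factor 1/(1-ρ_h) has already been bounded by
  -- 1/(1-r), which is part of `K`.
  have hS : 1 / (1 - rhoDiscrete L ν b h M Δ) ≤ constS L ν b h T M Δ :=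
    le_add_of_nonneg_left (one_div_nonneg.2 (sub_nonneg.2 (hρ.trans hr.le)))
  have hS0 : 0 ≤ constS L ν b h T M Δ := (one_div_nonneg.2 hρΔ'.le).trans hS
  have hqS : q ≤ p * constS L ν b h T M Δ := by
    rw [hq, div_eq_mul_one_div]
    gcongr
  rw [abs_of_nonneg hp]
  have haS : a / (1 - r) ≤ L * (∫ y, b y ∂ν) * p / (1 - r) *
      (constS L ν b h T M Δ * constR h T Δ) := by
    calc a / (1 - r) ≤ L * (∫ y, b y ∂ν) *
          (constR h T Δ * (p * constS L ν b h T M Δ)) / (1 - r) := by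
          rw [ha]; gcongr
      _ = _ := by ring
  set S : ℝ := constS L ν b h T M Δ * constR h T Δ
  have hS' : 0 ≤ S := mul_nonneg hS0 hCR
  set A : ℝ := L * (∫ y, b y ∂ν) * p / (1 - r)
  have hA : 0 ≤ A := by positivity
  set B : ℝ := p / (1 - r)
  have hB : 0 ≤ B := by positivity
  have hΔ0 : (0 : ℝ) ≤ Δ := Δ.coe_nonneg
  calc (∫ y, |y| ∂ν) * (g * (a / (1 - r)) + 2 * (Δ * B)) ≤
        (∫ y, |y| ∂ν) * (g * (A * S) + 2 * (Δ * B)) := by gcongr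
    -- The added terms are the nonnegative cross terms in the expansion of `K` times (Sg + Δ).
    _ ≤ (∫ y, |y| ∂ν) * (g * (A * S) + 2 * (Δ * B)) +
        ((∫ y, |y| ∂ν) * (A * Δ) + (∫ y, |y| ∂ν) * (2 * B) * (S * g) + (S * g + Δ)) :=
        le_add_of_nonneg_right (by positivity)
    _ = _ := by ring
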